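/- Let $k$ be a field of characteristic $\neq 2$. Superspaces are finite dimensional $\mathbb Z/2$-graded $k$-vector spaces $M=M_0\oplus M_1$. For $d\ge 0$ let $\mathfrak S_d$ act on $M^{\otimes d}$ from the right by $$(x_1\otimes\cdots\otimes x_d).\sigma=\Big(\prod_{s<t,\ \sigma^{-1}s>\sigma^{-1}t}(-1)^{|x_s||x_t|}\Big)\,x_{\sigma 1}\otimes\cdots\otimes x_{\sigma d}\qquad(x_i\text{ homogeneous}).$$ Let $\mathsf\Gamma^d$ be the category whose objects are the superspaces and whose morphisms $M\to N$ form the superspace $\Gamma^d\mathrm{Hom}(M,N)=\mathrm{Hom}_{\mathfrak S_d}(M^{\otimes d},N^{\otimes d})$, and let $\mathsf{Pol}^{\mathsf I}_d$ be the category of even $k$-linear functors from $\mathsf\Gamma^d$ to superspaces, with $I^{\otimes d}\in\mathsf{Pol}^{\mathsf I}_d$ the functor $M\mapsto M^{\otimes d}$. An even isomorphism in $\mathsf{Pol}^{\mathsf I}_d$ is a natural isomorphism all of whose components are even. For a composition $\alpha$ of $d$ with Young subgroup $\mathfrak S_\alpha\subseteq\mathfrak S_d$ let $S^\alpha=S^{\alpha_1}\otimes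 S^{\alpha_2}\otimes\cdots$ be the quotient $m:I^{\otimes d}\to S^\alpha=(I^{\otimes d})_{\mathfrak S_\alpha}$, and let $\Gamma_\Pi^\alpha=\Gamma_\Pi^{\alpha_1}\otimes\Gamma_\Pi^{\alpha_2}\otimes\cdots$, where $\Gamma_\Pi^{e}=\Gamma^{e}\circ\Pi$ for even $e$ and $\Gamma_\Pi^{e}=\Pi\circ\Gamma^{e}\circ\Pi$ for odd $e$ ($\Gamma^e$ the divided power, $\Pi$ the parity change). The sign-twisting identification $(\Pi M)^{\otimes d}\cong M^{\otimes d}$ gives an even embedding $\Delta_\Pi:\Gamma_\Pi^\alpha\hookrightarrow I^{\otimes d}$ with image $\{x: x.\sigma=\mathrm{sgn}(\sigma)\,x\ \ \forall\sigma\in\mathfrak S_\alpha\}$. Through $\Delta_\Pi$, the comultiplication of the divided powers superalgebra $\Gamma^\bullet(\Pi M)$ is the inclusion $\Gamma_\Pi^{e+f}\subseteq\Gamma_\Pi^e\otimes\Gamma_\Pi^f$, and its multiplication $\Gamma_\Pi^e\otimes\Gamma_\Pi^f\to\Gamma_\Pi^{e+f}$ is $x\mapsto\sum_\sigma\mathrm{sgn}(\sigma)\,x.\sigma$,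 summed over representatives of $(\mathfrak S_e\times\mathfrak S_f)\backslash\mathfrak S_{e+f}$. Let $\mu\subset\lambda$ be partitions with $|\lambda/\mu|=d$ and conjugates $\mu'\subset\lambda'$, and write $X^{\lambda/\mu}=X^{\lambda-\mu}$ for $X=S,\Gamma_\Pi$. Number the boxes of the skew diagram of $\lambda/\mu$ by rows (left to right, top to bottom) and by columns (downwards, left to right), and let $\sigma_{\lambda'/\mu'}\in\mathfrak S_d$ send the column number of each box to its row number. Define $$\hat\theta_{\lambda'/\mu'}:\ \Gamma_\Pi^{\lambda/\mu}\xrightarrow{\ \Delta_\Pi\ }I^{\otimes d}\xrightarrow{\ .\sigma_{\lambda'/\mu'}\ }I^{\otimes d}\xrightarrow{\ m\ }S^{\lambda'/\mu'},\qquad \widehat S_{\lambda'/\mu'}=\mathrm{Im}\,\hat\theta_{\lambda'/\mu'}.$$ For $i\ge1$ and $u,v\ge0$ with $u+v<\lambda_{i+1}-\mu_i$, put $p_1=\lambda_i-\mu_i$, $p_2=\lambda_{i+1}-\mu_{i+1}$, and let $\diamondsuit_i(\lambda/\mu,u,v)$ be the composite $$\Gamma_\Pi^u\otimes\Gamma_\Pi^{p_1-u+p_2-v}\otimes\Gamma_\Pi^v\xrightarrow{1\otimes\Delta\otimes1}\Gamma_\Pi^u\otimes\Gamma_\Pi^{p_1-u}\otimes\Gamma_\Pi^{p_2-v}\otimes\Gamma_\Pi^v\xrightarrow{m\otimes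 m}\Gamma_\Pi^{p_1}\otimes\Gamma_\Pi^{p_2}$$ of comultiplication and multiplications, tensored with the identity of the other factors $\Gamma_\Pi^{\lambda_j-\mu_j}$. Let $\mathrm{Im}\,\diamondsuit_{\lambda/\mu}\subseteq\Gamma_\Pi^{\lambda/\mu}$ be the sum of the images of these maps over all $i,u,v$. Let $M$ be a superspace with $\dim M_0=m$, $\dim M_1=n$, and let $Z_1,\dots,Z_{m+n}$ be a totally ordered homogeneous basis of $M$. A tableau $t$ of shape $\lambda/\mu$ with entries in $\{1,\dots,m+n\}$ is costandard if its rows and columns are nondecreasing, equal entries $s$ in a row occur only for odd $Z_s$, and equal entries $s$ in a column occur only for even $Z_s$. For such $t$ let $Z_\Pi^{(t)}\in\Gamma_\Pi^{\lambda/\mu}(M)$ be the tensor product over the rows $i$ of the products $(\Pi Z_1)^{(a_{i1})}\cdots(\Pi Z_{m+n})^{(a_{i,m+n})}$ of divided powers, where $a_{is}$ is the number of entries $s$ in row $i$ of $t$; it is normalized so that $Z_{w_1}\otimes\cdots\otimes Z_{w_d}$, with $w$ the row reading word of $t$, has coefficient $1$ in $\Delta_\Pi(Z_\Pi^{(t)})$.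 **Theorem.** The elements $\hat\theta_{\lambda'/\mu'}(Z_\Pi^{(t)})$, for $t$ costandard of shape $\lambda/\mu$, are linearly independent and form a basis of $\widehat S_{\lambda'/\mu'}(M)$. Moreover, there is an even isomorphism $$\widehat S_{\lambda'/\mu'}\ \simeq\ \Gamma_\Pi^{\lambda/\mu}\big/\mathrm{Im}\,\diamondsuit_{\lambda/\mu}\qquad\text{in }\mathsf{Pol}^{\mathsf I}_d .$$ -/

import Mathlib

open scoped TensorProduct

universe u

noncomputable section

namespace SchurSuper

/-! ### Superspaces -/

/-- A finite dimensional vector superspace over `k`: a finite dimensional vector space `M` with a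
decomposition `M = M₀ ⊕ M₁`. -/
structure SVec (k : Type u) [Field k] where
  carrier : Type u
  [addCommGroup : AddCommGroup carrier]
  [module : Module k carrier]
  [finite : Module.Finite k carrier]
  part : ZMod 2 → Submodule k carrier
  isCompl : IsCompl (part 0) (part 1)

attribute [instance] SVec.addCommGroup SVec.module SVec.finite

instance {k : Type u} [Field k] : CoeSort (SVec k) (Type u) := ⟨SVec.carrier⟩

section Superspaces

variable {k : Type u} [Field k]

/-- `sdim M = m|n`. -/
def SVec.HasSDim (M : SVec k) (m n : ℕ) : Prop :=
  Module.finrank k (M.part 0) = m ∧ Module.finrank k (M.part 1) = n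

/-- The projection of `M = M₀ ⊕ M₁` onto `M_ε`. -/
def SVec.proj (M : SVec k) (ε : ZMod 2) : M →ₗ[k] M :=
  if ε = 0 then (M.part 0).projection (M.part 1) M.isCompl
  else (M.part 1).projection (M.part 0) M.isCompl.symm

/-- `f` is `ℤ/2`-homogeneous of degree `ε`: `f (M_δ) ⊆ N_{ε+δ}`. -/
def IsHomog {M N : SVec k} (ε : ZMod 2) (f : M →ₗ[k] N) : Prop :=
  ∀ δ : ZMod 2, ∀ x ∈ M.part δ, f x ∈ N.part (ε + δ)

theorem zmod2_cases (ε : ZMod 2) : ε = 0 ∨ ε = 1 := by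
  revert ε; decide

theorem SVec.proj_mem (M : SVec k) (ε : ZMod 2) (x : M) : M.proj ε x ∈ M.part ε := by
  rcases zmod2_cases ε with rfl | rfl
  · simp only [SVec.proj, if_true]; exact Submodule.projection_apply_mem _ _
  · simp only [SVec.proj, one_ne_zero, if_false]; exact Submodule.projection_apply_mem _ _

theorem SVec.proj_of_mem (M : SVec k) {ε : ZMod 2} {x : M} (hx : x ∈ M.part ε) :
    M.proj ε x = x := by
  rcases zmod2_cases ε with rfl | rfl
  · simp only [SVec.proj, if_true]; exact Submodule.projection_apply_of_mem_left _ hx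
  · simp only [SVec.proj, one_ne_zero, if_false]; exact Submodule.projection_apply_of_mem_left _ hx

theorem SVec.proj_of_mem_ne (M : SVec k) {ε δ : ZMod 2} {x : M} (hx : x ∈ M.part δ)
    (h : ε ≠ δ) : M.proj ε x = 0 := by
  rcases zmod2_cases ε with rfl | rfl <;> rcases zmod2_cases δ with rfl | rfl
  · exact absurd rfl h
  · simp only [SVec.proj, if_true]; exact (Submodule.projection_apply_eq_zero_iff _).2 hx
  · simp only [SVec.proj, one_ne_zero, if_false]
    exact (Submodule.projection_apply_eq_zero_iff _).2 hx
  · exact absurd rfl h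

theorem SVec.proj_add_proj (M : SVec k) (x : M) : M.proj 0 x + M.proj 1 x = x := by
  simp only [SVec.proj, if_true, one_ne_zero, if_false]
  exact Submodule.projection_add_projection_eq_self _ _

theorem SVec.sum_proj (M : SVec k) : ∑ ε : ZMod 2, M.proj ε = LinearMap.id := by
  ext x
  have h : (Finset.univ : Finset (ZMod 2)) = {0, 1} := by decide
  rw [h, Finset.sum_pair (by decide)]
  exact M.proj_add_proj x

theorem SVec.eq_zero_of_mem (M : SVec k) {x : M} (h0 : x ∈ M.part 0) (h1 : x ∈ M.part 1) :
    x = 0 := (Submodule.disjoint_def.1 M.isCompl.disjoint) x h0 h1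

theorem IsHomog.proj_comm {M N : SVec k} {f : M →ₗ[k] N} (hf : IsHomog 0 f) (ε : ZMod 2) (x : M) :
    f (M.proj ε x) = N.proj ε (f x) := by
  have h : ∀ δ : ZMod 2, f (M.proj δ x) ∈ N.part δ := fun δ => by
    simpa using hf δ _ (M.proj_mem δ x)
  conv_rhs => rw [← M.proj_add_proj x, map_add, map_add]
  rcases zmod2_cases ε with rfl | rfl
  · rw [N.proj_of_mem (h 0), N.proj_of_mem_ne (h 1) (by decide), add_zero]
  · rw [N.proj_of_mem (h 1), N.proj_of_mem_ne (h 0) (by decide), zero_add]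

/-- A subsuperspace `U = (U ∩ M₀) ⊕ (U ∩ M₁)`, as a superspace. -/
abbrev SVec.sub (M : SVec k) (U : Submodule k M)
    (hU : ∀ ε, ∀ x ∈ U, M.proj ε x ∈ U) : SVec k where
  carrier := U
  part ε := (M.part ε).comap U.subtype
  isCompl := by
    constructor
    · rw [Submodule.disjoint_def]
      intro x h0 h1
      exact Subtype.ext (M.eq_zero_of_mem h0 h1)
    · rw [codisjoint_iff, eq_top_iff]
      intro x _
      have hx : x = ⟨M.proj 0 x, hU 0 x x.2⟩ + ⟨M.proj 1 x, hU 1 x x.2⟩ :=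
        Subtype.ext (M.proj_add_proj x).symm
      rw [hx]
      exact Submodule.add_mem_sup (M.proj_mem 0 _) (M.proj_mem 1 _)

/-- The quotient of a superspace by a subsuperspace. -/
abbrev SVec.quot (M : SVec k) (U : Submodule k M)
    (hU : ∀ ε, ∀ x ∈ U, M.proj ε x ∈ U) : SVec k where
  carrier := M ⧸ U
  part ε := (M.part ε).map U.mkQ
  isCompl := by
    constructor
    · rw [Submodule.disjoint_def]
      rintro _ ⟨x, hx, rfl⟩ ⟨y, hy, hxy⟩
      have h : y - x ∈ U := by
        rw [← Submodule.Quotient.eq]; exact hxy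
      have h2 := hU 0 _ h
      rw [map_sub, M.proj_of_mem_ne hy (by decide), M.proj_of_mem hx, zero_sub] at h2
      exact (Submodule.Quotient.mk_eq_zero U).2 (by simpa using h2)
    · rw [codisjoint_iff, ← Submodule.map_sup, M.isCompl.sup_eq_top, Submodule.map_top,
        Submodule.range_mkQ]

end Superspaces

/-! ### Tensor powers and the signed action of the symmetric group -/

section TensorPowers

variable {k : Type u} [Field k] {d : ℕ}

/-- The homogeneous component of degree `ε` of `M^{⊗d}`: the span of the tensors
`x₁ ⊗ ⋯ ⊗ x_d` with homogeneous entries whose degrees add up to `ε`. -/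
def tpowPart (M : SVec k) (d : ℕ) (ε : ZMod 2) : Submodule k (⨂[k]^d (M : Type u)) :=
  Submodule.span k {t | ∃ (p : Fin d → ZMod 2) (x : Fin d → M),
    ∑ i, p i = ε ∧ (∀ i, x i ∈ M.part (p i)) ∧ t = PiTensorProduct.tprod k x}

/-- The projection of `M^{⊗d}` to `M_{p 1} ⊗ ⋯ ⊗ M_{p d}`. -/
def tpowProj (M : SVec k) (p : Fin d → ZMod 2) :
    (⨂[k]^d (M : Type u)) →ₗ[k] (⨂[k]^d (M : Type u)) :=
  PiTensorProduct.map fun i => M.proj (p i)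

theorem sum_tpowProj (M : SVec k) (t : ⨂[k]^d (M : Type u)) :
    ∑ p : Fin d → ZMod 2, tpowProj M p t = t := by
  have h : ∑ p : Fin d → ZMod 2, tpowProj (d := d) M p = LinearMap.id := by
    apply PiTensorProduct.ext
    ext x
    simp only [LinearMap.compMultilinearMap_apply, LinearMap.sum_apply, tpowProj,
      PiTensorProduct.map_tprod, LinearMap.id_apply]
    rw [← MultilinearMap.map_sum (PiTensorProduct.tprod k) (fun i (ε : ZMod 2) => M.proj ε (x i))]
    congr 1
    funext i
    have := LinearMap.congr_fun M.sum_proj (x i)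
    simpa using this
  have := LinearMap.congr_fun h t
  simpa using this

theorem tpowProj_tprod_self (M : SVec k) {p : Fin d → ZMod 2} {x : Fin d → M}
    (hx : ∀ i, x i ∈ M.part (p i)) :
    tpowProj M p (PiTensorProduct.tprod k x) = PiTensorProduct.tprod k x := by
  simp only [tpowProj, PiTensorProduct.map_tprod]
  congr 1
  funext i
  exact M.proj_of_mem (hx i)

theorem tpowProj_tprod_ne (M : SVec k) {p q : Fin d → ZMod 2} {x : Fin d → M}
    (hx : ∀ i, x i ∈ M.part (q i)) (h : p ≠ q) :
    tpowProj M p (PiTensorProduct.tprod k x) = 0 := by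
  simp only [tpowProj, PiTensorProduct.map_tprod]
  obtain ⟨i, hi⟩ := Function.ne_iff.1 h
  exact (PiTensorProduct.tprod k).map_coord_zero i (M.proj_of_mem_ne (hx i) hi)

theorem tpowProj_mem (M : SVec k) (p : Fin d → ZMod 2) (t : ⨂[k]^d (M : Type u)) :
    tpowProj M p t ∈ tpowPart M d (∑ i, p i) := by
  induction t using PiTensorProduct.induction_on with
  | smul_tprod r x =>
    rw [map_smul]
    refine Submodule.smul_mem _ _ (Submodule.subset_span ⟨p, fun i => M.proj (p i) (x i), rfl,
      fun i => M.proj_mem _ _, ?_⟩)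
    simp only [tpowProj, PiTensorProduct.map_tprod]
  | add x y hx hy => rw [map_add]; exact Submodule.add_mem _ hx hy

/-- The projection of `M^{⊗d}` to its component of degree `ε`. -/
def tpowGr (M : SVec k) (d : ℕ) (ε : ZMod 2) :
    (⨂[k]^d (M : Type u)) →ₗ[k] (⨂[k]^d (M : Type u)) :=
  ∑ p ∈ (Finset.univ : Finset (Fin d → ZMod 2)).filter (fun p => ∑ i, p i = ε), tpowProj M p

theorem tpowGr_of_mem (M : SVec k) {ε : ZMod 2} {t : ⨂[k]^d (M : Type u)}
    (ht : t ∈ tpowPart M d ε) (δ : ZMod 2) : tpowGr M d δ t = if δ = ε then t else 0 := by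
  induction ht using Submodule.span_induction with
  | mem t ht =>
    obtain ⟨p, x, hp, hx, rfl⟩ := ht
    rw [tpowGr, LinearMap.sum_apply]
    split_ifs with h
    · rw [Finset.sum_eq_single p, tpowProj_tprod_self M hx]
      · intro q _ hq
        exact tpowProj_tprod_ne M hx hq
      · intro hq
        exact absurd (by simp [hp, h]) hq
    · refine Finset.sum_eq_zero fun q hq => tpowProj_tprod_ne M hx ?_
      rintro rfl
      exact h (by rw [← (Finset.mem_filter.1 hq).2, hp])
  | zero => simp
  | add x y _ _ hx hy => rw [map_add, hx, hy]; split_ifs <;> simp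
  | smul a x _ hx => rw [map_smul, hx]; split_ifs <;> simp

/-- The tensor power `M^{⊗d}` as a superspace. -/
abbrev tpow (M : SVec k) (d : ℕ) : SVec k where
  carrier := ⨂[k]^d (M : Type u)
  finite := PiTensorProduct.finite
  part := tpowPart M d
  isCompl := by
    constructor
    · rw [Submodule.disjoint_def]
      intro t h0 h1
      have e0 := tpowGr_of_mem M h0 0
      have e1 := tpowGr_of_mem M h1 0
      rw [if_pos rfl] at e0
      rw [if_neg (by decide)] at e1
      rw [← e0, e1]
    · rw [codisjoint_iff, eq_top_iff]
      intro t _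
      rw [← sum_tpowProj M t]
      refine Submodule.sum_mem _ fun p _ => ?_
      rcases zmod2_cases (∑ i, p i) with h | h
      · exact Submodule.mem_sup_left (h ▸ tpowProj_mem M p t)
      · exact Submodule.mem_sup_right (h ▸ tpowProj_mem M p t)

/-- The sign `∏_{s < t, σ⁻¹ s > σ⁻¹ t} (-1)^{p_s p_t}`. -/
def koszulSign (p : Fin d → ZMod 2) (σ : Equiv.Perm (Fin d)) : ℤˣ :=
  ∏ t, ∏ s ∈ Finset.Iio t, if σ⁻¹ t < σ⁻¹ s then (-1) ^ (p s * p t).val else 1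

/-- The right action of `σ ∈ 𝔖_d` on `M^{⊗d}`: for homogeneous `x_i` of degree `p_i`,
`(x₁ ⊗ ⋯ ⊗ x_d).σ = koszulSign p σ • x_{σ 1} ⊗ ⋯ ⊗ x_{σ d}`. -/
def superAct (M : SVec k) (σ : Equiv.Perm (Fin d)) : tpow M d →ₗ[k] tpow M d :=
  ∑ p : Fin d → ZMod 2, ((koszulSign p σ : ℤ) : k) •
    ((PiTensorProduct.reindex k (fun _ : Fin d => (M : Type u)) σ.symm).toLinearMap ∘ₗ
      tpowProj M p)

theorem superAct_tprod (M : SVec k) (σ : Equiv.Perm (Fin d)) {p : Fin d → ZMod 2}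
    {x : Fin d → M} (hx : ∀ i, x i ∈ M.part (p i)) :
    superAct M σ (PiTensorProduct.tprod k x) =
      ((koszulSign p σ : ℤ) : k) • PiTensorProduct.tprod k (fun i => x (σ i)) := by
  rw [superAct, LinearMap.sum_apply, Finset.sum_eq_single p]
  · rw [LinearMap.smul_apply, LinearMap.comp_apply, tpowProj_tprod_self M hx]
    congr 1
    exact PiTensorProduct.reindex_tprod _ _
  · intro q _ hq
    rw [LinearMap.smul_apply, LinearMap.comp_apply, tpowProj_tprod_ne M hx hq, map_zero, smul_zero]
  · simp

theorem tpow_induction (M : SVec k) {P : tpow M d → Prop}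
    (h : ∀ (p : Fin d → ZMod 2) (x : Fin d → M), (∀ i, x i ∈ M.part (p i)) →
      P (PiTensorProduct.tprod k x))
    (hadd : ∀ x y, P x → P y → P (x + y)) (hsmul : ∀ (a : k) x, P x → P (a • x))
    (t : tpow M d) : P t := by
  have h0 : P 0 := by simpa using hsmul 0 _ (h 0 (fun _ => 0) fun i => Submodule.zero_mem _)
  have key : ∀ ε, ∀ t ∈ tpowPart M d ε, P t := by
    intro ε t ht
    induction ht using Submodule.span_induction with
    | mem t ht =>
      obtain ⟨p, x, _, hx, rfl⟩ := ht
      exact h p x hx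
    | zero => exact h0
    | add x y _ _ hx hy => exact hadd _ _ hx hy
    | smul a x _ hx => exact hsmul _ _ hx
  rw [← (tpow M d).proj_add_proj t]
  exact hadd _ _ (key 0 _ ((tpow M d).proj_mem 0 t)) (key 1 _ ((tpow M d).proj_mem 1 t))

theorem superAct_even (M : SVec k) (σ : Equiv.Perm (Fin d)) : IsHomog 0 (superAct M σ) := by
  intro ε t ht
  rw [zero_add]
  change t ∈ tpowPart M d ε at ht
  induction ht using Submodule.span_induction with
  | mem t ht =>
    obtain ⟨p, x, hp, hx, rfl⟩ := ht
    rw [superAct_tprod M σ hx]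
    exact Submodule.smul_mem _ _ (Submodule.subset_span
      ⟨fun i => p (σ i), fun i => x (σ i), by rw [← hp]; exact Equiv.sum_comp σ p,
        fun i => hx _, rfl⟩)
  | zero => rw [map_zero]; exact Submodule.zero_mem _
  | add x y _ _ hx hy => rw [map_add]; exact Submodule.add_mem _ hx hy
  | smul a x _ hx => rw [map_smul]; exact Submodule.smul_mem _ _ hx

theorem prod_pairs_comp {A : Type*} [CommMonoid A] (σ : Equiv.Perm (Fin d))
    (f : Fin d → Fin d → A) (hf : ∀ i j, f i j = f j i) :
    ∏ t, ∏ s ∈ Finset.Iio t, f (σ s) (σ t) = ∏ t, ∏ s ∈ Finset.Iio t, f s t := by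
  rw [Finset.prod_sigma', Finset.prod_sigma']
  have h1 : ∀ a b : Fin d, b < a → σ b ≠ σ a := fun a b h e => h.ne (σ.injective e)
  refine Finset.prod_bij'
    (fun x _ => ⟨max (σ x.1) (σ x.2), min (σ x.1) (σ x.2)⟩)
    (fun x _ => ⟨max (σ.symm x.1) (σ.symm x.2), min (σ.symm x.1) (σ.symm x.2)⟩) ?_ ?_ ?_ ?_ ?_
  · rintro ⟨a, b⟩ h
    have h : b < a := by simpa using h
    simpa using h1 a b h
  · rintro ⟨a, b⟩ h
    have h : b < a := by simpa using h
    simpa using h.ne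
  · rintro ⟨a, b⟩ h
    have h : b < a := by simpa using h
    rcases lt_or_ge (σ a) (σ b) with h' | h'
    · simp [max_eq_right h'.le, min_eq_left h'.le, h.le]
    · simp [max_eq_left h', min_eq_right h', h.le]
  · rintro ⟨a, b⟩ h
    have h : b < a := by simpa using h
    rcases lt_or_ge (σ.symm a) (σ.symm b) with h' | h'
    · simp [max_eq_right h'.le, min_eq_left h'.le, h.le]
    · simp [max_eq_left h', min_eq_right h', h.le]
  · rintro ⟨a, b⟩ h
    rcases lt_or_ge (σ a) (σ b) with h' | h'
    · simp only [max_eq_right h'.le, min_eq_left h'.le]; exact hf _ _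
    · simp only [max_eq_left h', min_eq_right h']

theorem koszulSign_mul (p : Fin d → ZMod 2) (σ τ : Equiv.Perm (Fin d)) :
    koszulSign p (σ * τ) = koszulSign p σ * koszulSign (fun i => p (σ i)) τ := by
  let c : Fin d → Fin d → ℤˣ := fun s t => (-1) ^ (p s * p t).val
  have hc : ∀ s t, c s t = c t s := fun s t => by simp only [c, mul_comm]
  let f : Fin d → Fin d → ℤˣ := fun s t =>
    if ((σ⁻¹ s < σ⁻¹ t) ↔ (τ⁻¹ (σ⁻¹ t) < τ⁻¹ (σ⁻¹ s))) then c s t else 1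
  have hf' : ∀ i j, i ≠ j → f i j = f j i := by
    intro i j hij
    have h1 : σ⁻¹ i ≠ σ⁻¹ j := fun e => hij (σ⁻¹.injective e)
    have h2 : τ⁻¹ (σ⁻¹ i) ≠ τ⁻¹ (σ⁻¹ j) := fun e => h1 (τ⁻¹.injective e)
    simp only [f, hc i j]
    congr 1
    rw [eq_iff_iff]
    rcases lt_or_gt_of_ne h1 with a | a <;> rcases lt_or_gt_of_ne h2 with b | b <;>
      simp only [a, b, a.not_gt, b.not_gt, iff_false, iff_true, not_true]
  have hf : ∀ i j, f i j = f j i := by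
    intro i j
    by_cases h : i = j
    · rw [h]
    · exact hf' i j h
  have e : koszulSign (fun i => p (σ i)) τ = ∏ t, ∏ s ∈ Finset.Iio t, f s t := by
    rw [← prod_pairs_comp σ f hf, koszulSign]
    refine Finset.prod_congr rfl fun t _ => Finset.prod_congr rfl fun s hs => ?_
    have hs : s < t := by simpa using hs
    simp [f, c, hs]
  rw [e, koszulSign, koszulSign, ← Finset.prod_mul_distrib]
  refine Finset.prod_congr rfl fun t _ => ?_
  rw [← Finset.prod_mul_distrib]
  refine Finset.prod_congr rfl fun s hs => ?_
  have hs : s < t := by simpa using hs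
  have h1 : σ⁻¹ s ≠ σ⁻¹ t := fun e => hs.ne (σ⁻¹.injective e)
  have h2 : τ⁻¹ (σ⁻¹ s) ≠ τ⁻¹ (σ⁻¹ t) := fun e => h1 (τ⁻¹.injective e)
  have h3 : c s t * c s t = 1 := Int.units_mul_self _
  change (if (σ * τ)⁻¹ t < (σ * τ)⁻¹ s then c s t else 1) =
    (if σ⁻¹ t < σ⁻¹ s then c s t else 1) * f s t
  simp only [mul_inv_rev, Equiv.Perm.mul_apply, f]
  rcases lt_or_gt_of_ne h1 with a | a <;> rcases lt_or_gt_of_ne h2 with b | b <;>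
    simp only [a, b, a.not_gt, b.not_gt, h3, if_true, if_false, iff_true, iff_false, not_true,
      mul_one, one_mul]

/-- `(x.σ).τ = x.(στ)`. -/
theorem superAct_superAct (M : SVec k) (σ τ : Equiv.Perm (Fin d)) (t : tpow M d) :
    superAct M τ (superAct M σ t) = superAct M (σ * τ) t := by
  induction t using tpow_induction M with
  | h p x hx =>
    rw [superAct_tprod M σ hx, map_smul, superAct_tprod M τ (fun i => hx (σ i)),
      superAct_tprod M (σ * τ) hx, koszulSign_mul, smul_smul]
    push_cast
    rfl
  | hadd x y hx hy => simp only [map_add, hx, hy]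
  | hsmul a x hx => simp only [map_smul, hx]

end TensorPowers

/-! ### Strict polynomial superfunctors of type I -/

section Functors

variable {k : Type u} [Field k] {d : ℕ}

/-- The morphisms `M → N` of the category `Γ^d_M`: the space
`Γ^d Hom(M, N) = Hom_{𝔖_d}(M^{⊗d}, N^{⊗d})`, composed as linear maps. -/
def divHom (d : ℕ) (M N : SVec k) : Submodule k (tpow M d →ₗ[k] tpow N d) where
  carrier := {φ | ∀ (σ : Equiv.Perm (Fin d)) (x : tpow M d),
    φ (superAct M σ x) = superAct N σ (φ x)}
  add_mem' := by
    intro a b ha hb σ x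
    simp only [LinearMap.add_apply, ha σ x, hb σ x, map_add]
  zero_mem' := by
    intro σ x
    simp
  smul_mem' := by
    intro c a ha σ x
    simp only [LinearMap.smul_apply, ha σ x, map_smul]

/-- The identity morphism of `M` in `Γ^d_M`. -/
def divId (d : ℕ) (M : SVec k) : divHom d M M := ⟨LinearMap.id, fun _ _ => rfl⟩

/-- Composition in `Γ^d_M`. -/
def divComp {L M N : SVec k} (ψ : divHom d M N) (φ : divHom d L M) : divHom d L N :=
  ⟨ψ.1 ∘ₗ φ.1, fun σ x => by simp only [LinearMap.comp_apply, φ.2 σ x, ψ.2 σ]⟩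

/-- An object of `Pol^I_d`: an even `k`-linear functor `Γ^d_M → svec`. -/
structure PolI (k : Type u) [Field k] (d : ℕ) where
  obj : SVec k → SVec k
  map : ∀ {M N : SVec k}, divHom d M N →ₗ[k] (obj M →ₗ[k] obj N)
  map_id : ∀ M, map (divId d M) = LinearMap.id
  map_comp : ∀ {L M N : SVec k} (ψ : divHom d M N) (φ : divHom d L M),
    map (divComp ψ φ) = map ψ ∘ₗ map φ
  map_homog : ∀ {M N : SVec k} (ε : ZMod 2) (φ : divHom d M N),
    IsHomog ε φ.1 → IsHomog ε (map φ)

/-- An even `Svec`-enriched natural transformation. -/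
structure EvenTrans (F G : PolI k d) where
  app : ∀ M : SVec k, F.obj M →ₗ[k] G.obj M
  even : ∀ M, IsHomog 0 (app M)
  natural : ∀ {M N : SVec k} (φ : divHom d M N) (x : F.obj M),
    app N (F.map φ x) = G.map φ (app M x)

/-- Composition of even natural transformations. -/
def EvenTrans.comp {F G H : PolI k d} (η : EvenTrans G H) (ζ : EvenTrans F G) :
    EvenTrans F H where
  app M := η.app M ∘ₗ ζ.app M
  even M δ x hx := by
    have h := η.even M _ _ (ζ.even M δ x hx)
    rwa [zero_add] at h
  natural φ x := by
    simp only [LinearMap.comp_apply, ζ.natural, η.natural]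

/-- There is an even isomorphism `F ≃ G` in `Pol^I_d`. -/
def EvenIso (F G : PolI k d) : Prop :=
  ∃ (η : EvenTrans F G) (ζ : EvenTrans G F),
    (∀ M x, ζ.app M (η.app M x) = x) ∧ ∀ M y, η.app M (ζ.app M y) = y

/-- A subfunctor of `F`: a family of subsuperspaces stable under all morphisms. -/
structure SubPol (F : PolI k d) where
  sub : ∀ M : SVec k, Submodule k (F.obj M)
  graded : ∀ (M : SVec k) (ε : ZMod 2), ∀ x ∈ sub M, (F.obj M).proj ε x ∈ sub M
  stable : ∀ {M N : SVec k} (φ : divHom d M N), ∀ x ∈ sub M, F.map φ x ∈ sub N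

/-- A subfunctor as an object of `Pol^I_d`. -/
abbrev SubPol.toPol {F : PolI k d} (U : SubPol F) : PolI k d where
  obj M := (F.obj M).sub (U.sub M) (U.graded M)
  map {M N} :=
    { toFun := fun φ => (F.map φ).restrict (U.stable φ)
      map_add' := fun φ ψ => by ext x; simp [LinearMap.restrict_apply]
      map_smul' := fun c φ => by ext x; simp [LinearMap.restrict_apply] }
  map_id M := by
    ext x
    simp [LinearMap.restrict_apply, F.map_id]
  map_comp ψ φ := by
    ext x
    simp [LinearMap.restrict_apply, F.map_comp]
  map_homog ε φ hφ δ x hx := F.map_homog ε φ hφ δ _ hx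

/-- The quotient of `F` by a subfunctor. -/
abbrev SubPol.quotient {F : PolI k d} (U : SubPol F) : PolI k d where
  obj M := (F.obj M).quot (U.sub M) (U.graded M)
  map {M N} :=
    { toFun := fun φ => (U.sub M).mapQ (U.sub N) (F.map φ) (U.stable φ)
      map_add' := fun φ ψ => by
        apply Submodule.linearMap_qext; ext x; simp
      map_smul' := fun c φ => by
        apply Submodule.linearMap_qext; ext x; simp }
  map_id M := by
    apply Submodule.linearMap_qext; ext x; simp [F.map_id]
  map_comp ψ φ := by
    apply Submodule.linearMap_qext; ext x; simp [F.map_comp]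
  map_homog ε φ hφ δ := by
    rintro _ ⟨x, hx, rfl⟩
    exact ⟨F.map φ x, F.map_homog ε φ hφ δ x hx, rfl⟩

/-- The inclusion of a subfunctor. -/
def SubPol.incl {F : PolI k d} (U : SubPol F) : EvenTrans U.toPol F where
  app M := (U.sub M).subtype
  even M δ x hx := by rw [zero_add]; exact hx
  natural φ x := rfl

/-- The projection to the quotient by a subfunctor. -/
def SubPol.proj {F : PolI k d} (U : SubPol F) : EvenTrans F U.quotient where
  app M := (U.sub M).mkQ
  even M δ x hx := by rw [zero_add]; exact ⟨x, hx, rfl⟩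
  natural φ x := rfl

/-- The image of an even natural transformation, as a subfunctor of its target. -/
def EvenTrans.image {F G : PolI k d} (η : EvenTrans F G) : SubPol G where
  sub M := LinearMap.range (η.app M)
  graded M ε := by
    rintro _ ⟨x, rfl⟩
    exact ⟨(F.obj M).proj ε x, (η.even M).proj_comm ε x⟩
  stable φ := by
    rintro _ ⟨x, rfl⟩
    exact ⟨F.map φ x, η.natural φ x⟩

/-- The corestriction `F → Im η` of `η : F → G`. -/
def EvenTrans.toImage {F G : PolI k d} (η : EvenTrans F G) : EvenTrans F η.image.toPol where
  app M := (η.app M).rangeRestrict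
  even M δ x hx := η.even M δ x hx
  natural φ x := Subtype.ext (η.natural φ x)

/-- The sum of a family of subfunctors. -/
def SubPol.iSup {F : PolI k d} {ι : Type} (U : ι → SubPol F) : SubPol F where
  sub M := ⨆ i, (U i).sub M
  graded M ε x hx := by
    have h : (⨆ i, (U i).sub M) ≤ (⨆ i, (U i).sub M).comap ((F.obj M).proj ε) :=
      iSup_le fun i y hy => Submodule.mem_iSup_of_mem i ((U i).graded M ε y hy)
    exact h hx
  stable {M N} φ x hx := by
    have h : (⨆ i, (U i).sub M) ≤ (⨆ i, (U i).sub N).comap (F.map φ) :=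
      iSup_le fun i y hy => Submodule.mem_iSup_of_mem i ((U i).stable φ y hy)
    exact h hx

/-- The functor `I^{⊗d}`. -/
abbrev tensorPol (k : Type u) [Field k] (d : ℕ) : PolI k d where
  obj M := tpow M d
  map := (divHom d _ _).subtype
  map_id _ := rfl
  map_comp _ _ := rfl
  map_homog _ _ h := h

/-- The action of `σ ∈ 𝔖_d` on `I^{⊗d}`. -/
def actTrans (k : Type u) [Field k] (σ : Equiv.Perm (Fin d)) :
    EvenTrans (tensorPol k d) (tensorPol k d) where
  app M := superAct M σ
  even M := superAct_even M σ
  natural φ x := (φ.2 σ x).symm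

end Functors

/-! ### Divided and symmetric powers

A composition `α` of `d` is encoded by the function `b` that sends each of the `d` places to the
block (of size `α_i`) in which it lies. -/

section Powers

variable {k : Type u} [Field k] {d : ℕ} {β γ : Type}

/-- The Young subgroup `𝔖_α ⊆ 𝔖_d` of the permutations that preserve each block of `b`. -/
def youngSubgroup (b : Fin d → β) : Subgroup (Equiv.Perm (Fin d)) where
  carrier := {σ | ∀ r, b (σ r) = b r}
  mul_mem' := by
    intro σ τ hσ hτ r
    rw [Equiv.Perm.mul_apply, hσ, hτ]
  one_mem' := fun _ => rfl
  inv_mem' := by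
    intro σ hσ r
    have h := hσ (σ⁻¹ r)
    rw [show σ (σ⁻¹ r) = r from σ.apply_symm_apply r] at h
    exact h.symm

/-- `Γ_Π^α = Γ_Π^{α_1} ⊗ Γ_Π^{α_2} ⊗ ⋯`, identified with its image under the canonical even
embedding `Δ_Π` in `I^{⊗d}`. The isomorphism `(ΠM)^{⊗d} ≅ M^{⊗d}` twists the action of `𝔖_d` by
the sign character, so the divided power `Γ^e(ΠM) = ((ΠM)^{⊗e})^{𝔖_e}` becomes the space of all
`x ∈ M^{⊗e}` with `x.σ = sgn(σ) x`, and the tensor product over the blocks becomes the space of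
all `x ∈ M^{⊗d}` with this property for the Young subgroup. The grading is that of `M^{⊗d}`; so
`Γ_Π^α` is `Γ^α ∘ Π` for even `d` and `Π ∘ Γ^α ∘ Π` for odd `d`. -/
def gammaPiSpace (M : SVec k) (b : Fin d → β) : Submodule k (tpow M d) where
  carrier := {x | ∀ σ ∈ youngSubgroup b,
    superAct M σ x = ((Equiv.Perm.sign σ : ℤ) : k) • x}
  add_mem' := by
    intro x y hx hy σ hσ
    rw [map_add, hx σ hσ, hy σ hσ, smul_add]
  zero_mem' := by
    intro σ _
    rw [map_zero, smul_zero]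
  smul_mem' := by
    intro c x hx σ hσ
    rw [map_smul, hx σ hσ, smul_comm]

/-- The family of the spaces `Γ_Π^α M`, as a subfunctor of `I^{⊗d}`. -/
abbrev gammaPiSub (k : Type u) [Field k] (b : Fin d → β) : SubPol (tensorPol k d) where
  sub M := gammaPiSpace M b
  graded M ε x hx σ hσ := by
    have h := (superAct_even M σ).proj_comm ε x
    rw [hx σ hσ, map_smul] at h
    exact h
  stable φ x hx σ hσ := by
    have h := φ.2 σ x
    rw [hx σ hσ, map_smul] at h
    exact h.symm

/-- The functor `Γ_Π^α`. -/
abbrev gammaPi (k : Type u) [Field k] (b : Fin d → β) : PolI k d := (gammaPiSub k b).toPol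

/-- The embedding `Δ_Π : Γ_Π^α → I^{⊗d}`. -/
def deltaPi (k : Type u) [Field k] (b : Fin d → β) : EvenTrans (gammaPi k b) (tensorPol k d) :=
  (gammaPiSub k b).incl

/-- The kernel of the multiplication `M^{⊗d} → S^α M = S^{α_1} M ⊗ S^{α_2} M ⊗ ⋯`. -/
def symKerSpace (M : SVec k) (b : Fin d → β) : Submodule k (tpow M d) :=
  Submodule.span k {y | ∃ σ ∈ youngSubgroup b, ∃ x : tpow M d, y = superAct M σ x - x}

/-- The family of these kernels, as a subfunctor of `I^{⊗d}`. -/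
abbrev symKer (k : Type u) [Field k] (b : Fin d → β) : SubPol (tensorPol k d) where
  sub M := symKerSpace M b
  graded M ε x hx := by
    have h : symKerSpace M b ≤ (symKerSpace M b).comap ((tpow M d).proj ε) := by
      refine Submodule.span_le.2 ?_
      rintro _ ⟨σ, hσ, x, rfl⟩
      refine Submodule.subset_span ⟨σ, hσ, (tpow M d).proj ε x, ?_⟩
      rw [(superAct_even M σ).proj_comm ε x, map_sub]
    exact h hx
  stable {M N} φ x hx := by
    have h : symKerSpace M b ≤ (symKerSpace N b).comap φ.1 := by
      refine Submodule.span_le.2 ?_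
      rintro _ ⟨σ, hσ, x, rfl⟩
      refine Submodule.subset_span ⟨σ, hσ, φ.1 x, ?_⟩
      rw [← φ.2 σ x, map_sub]
    exact h hx

/-- The functor `S^α = S^{α_1} ⊗ S^{α_2} ⊗ ⋯ = (I^{⊗d})_{𝔖_α}`. -/
abbrev symPol (k : Type u) [Field k] (b : Fin d → β) : PolI k d := (symKer k b).quotient

/-- The multiplication `m : I^{⊗d} → S^α`. -/
def symMul (k : Type u) [Field k] (b : Fin d → β) : EvenTrans (tensorPol k d) (symPol k b) :=
  (symKer k b).proj

/-- The comultiplication `Γ_Π^α → Γ_Π^{α'}` for blocks `f` that refine the blocks `b`: inside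
`I^{⊗d}` it is the inclusion. -/
def gammaComul (k : Type u) [Field k] (b : Fin d → β) (f : Fin d → γ)
    (h : youngSubgroup f ≤ youngSubgroup b) : EvenTrans (gammaPi k b) (gammaPi k f) where
  app M := Submodule.inclusion fun _ hx σ hσ => hx σ (h hσ)
  even M δ x hx := by rw [zero_add]; exact hx
  natural φ x := rfl

open Classical in
/-- The signed sum over the cosets of `H = 𝔖_f ∩ 𝔖_b` in `𝔖_b`. Representatives act through
their inverses, because the action is from the right and it is applied to elements on which `H`
acts by the sign; so the value does not depend on the representatives. -/
def cosetSum (M : SVec k) (f : Fin d → γ) (b : Fin d → β) : tpow M d →ₗ[k] tpow M d :=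
  ∑ q : youngSubgroup b ⧸ (youngSubgroup f).subgroupOf (youngSubgroup b),
    ((Equiv.Perm.sign (q.out : Equiv.Perm (Fin d)) : ℤ) : k) •
      superAct M (q.out : Equiv.Perm (Fin d))⁻¹

theorem sign_mul_self_cast (σ : Equiv.Perm (Fin d)) :
    ((Equiv.Perm.sign σ : ℤ) : k) * ((Equiv.Perm.sign σ : ℤ) : k) = 1 := by
  rw [← Int.cast_mul, ← Units.val_mul, Int.units_mul_self]; simp

theorem coset_term_eq (M : SVec k) (f : Fin d → γ) (b : Fin d → β) {x : tpow M d}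
    (hx : x ∈ gammaPiSpace M f) {g h : youngSubgroup b}
    (hgh : (QuotientGroup.mk g : youngSubgroup b ⧸
      (youngSubgroup f).subgroupOf (youngSubgroup b)) = QuotientGroup.mk h) :
    ((Equiv.Perm.sign (g : Equiv.Perm (Fin d)) : ℤ) : k) •
        superAct M (g : Equiv.Perm (Fin d))⁻¹ x =
      ((Equiv.Perm.sign (h : Equiv.Perm (Fin d)) : ℤ) : k) •
        superAct M (h : Equiv.Perm (Fin d))⁻¹ x := by
  have hm : ((g : Equiv.Perm (Fin d))⁻¹ * h) ∈ youngSubgroup f := by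
    have := QuotientGroup.eq.1 hgh
    simpa [Subgroup.mem_subgroupOf] using this
  have e : (g : Equiv.Perm (Fin d))⁻¹ = ((g : Equiv.Perm (Fin d))⁻¹ * h) *
      (h : Equiv.Perm (Fin d))⁻¹ := by group
  rw [e, ← superAct_superAct, hx _ hm, map_smul, smul_smul, Equiv.Perm.sign_mul,
    Equiv.Perm.sign_inv, Units.val_mul, Int.cast_mul, ← mul_assoc, sign_mul_self_cast, one_mul]

theorem cosetSum_mem (M : SVec k) (f : Fin d → γ) (b : Fin d → β) {x : tpow M d}
    (hx : x ∈ gammaPiSpace M f) : cosetSum M f b x ∈ gammaPiSpace M b := by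
  classical
  intro τ hτ
  let T : youngSubgroup b := ⟨τ, hτ⟩
  simp only [cosetSum, LinearMap.sum_apply, LinearMap.smul_apply, map_sum, map_smul,
    Finset.smul_sum]
  refine Fintype.sum_equiv (MulAction.toPerm T⁻¹) _ _ fun q => ?_
  have h1 : (QuotientGroup.mk (T⁻¹ * q.out) : youngSubgroup b ⧸
      (youngSubgroup f).subgroupOf (youngSubgroup b)) =
      QuotientGroup.mk ((MulAction.toPerm T⁻¹ q).out) := by
    rw [QuotientGroup.out_eq', MulAction.toPerm_apply]
    conv_rhs => rw [← QuotientGroup.out_eq' q]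
    rfl
  rw [← coset_term_eq M f b hx h1, smul_smul]
  simp only [T, Subgroup.coe_mul, Subgroup.coe_inv, mul_inv_rev, inv_inv, Equiv.Perm.sign_mul,
    Equiv.Perm.sign_inv, Units.val_mul, Int.cast_mul]
  rw [← mul_assoc, sign_mul_self_cast, one_mul, superAct_superAct]

/-- The multiplication `Γ_Π^{α'} → Γ_Π^α` of the divided powers superalgebra, for blocks `f` that
refine the blocks `b`: inside `I^{⊗d}` it is the signed sum over cosets. -/
def gammaMul (k : Type u) [Field k] (f : Fin d → γ) (b : Fin d → β) :
    EvenTrans (gammaPi k f) (gammaPi k b) where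
  app M := (cosetSum M f b).restrict fun _ hx => cosetSum_mem M f b hx
  even M δ x hx := by
    rw [zero_add]
    change cosetSum M f b x.1 ∈ tpowPart M d δ
    simp only [cosetSum, LinearMap.sum_apply, LinearMap.smul_apply]
    refine Submodule.sum_mem _ fun q _ => Submodule.smul_mem _ _ ?_
    have h := superAct_even M (q.out : Equiv.Perm (Fin d))⁻¹ δ x.1 hx
    rwa [zero_add] at h
  natural {M N} φ x := by
    apply Subtype.ext
    change cosetSum N f b (φ.1 x.1) = φ.1 (cosetSum M f b x.1)
    simp only [cosetSum, LinearMap.sum_apply, LinearMap.smul_apply, map_sum, map_smul]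
    exact Finset.sum_congr rfl fun q _ => by rw [φ.2]

end Powers

/-! ### Skew shapes, Schur superfunctors, tableaux -/

section Shapes

/-- The boxes of the skew diagram of `λ/μ` (row and column indices start at `0`). -/
def skewCells (lam mu : YoungDiagram) : Finset (ℕ × ℕ) := lam.cells \ mu.cells

/-- `|λ/μ|`. -/
abbrev skewSize (lam mu : YoungDiagram) : ℕ := (skewCells lam mu).card

/-- The numbering of a finite set of boxes from left to right in rows and from top to bottom. -/
def rowRead (s : Finset (ℕ × ℕ)) : Fin s.card ≃ s :=
  ((s.map (toLex (α := ℕ × ℕ)).toEmbedding).orderIsoOfFin (Finset.card_map _)).toEquiv.trans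
    ((toLex (α := ℕ × ℕ)).subtypeEquiv fun a => by simp).symm

/-- The numbering of a finite set of boxes down columns and from left to right. -/
def colRead (s : Finset (ℕ × ℕ)) : Fin s.card ≃ s :=
  ((s.map ((Equiv.prodComm ℕ ℕ).trans toLex).toEmbedding).orderIsoOfFin
    (Finset.card_map _)).toEquiv.trans
      (((Equiv.prodComm ℕ ℕ).trans toLex).subtypeEquiv fun a => by
        simp only [Finset.mem_map_equiv, Equiv.symm_apply_apply]).symm

variable (lam mu : YoungDiagram)

/-- The row of the `r`-th box in the row reading of `λ/μ`: the blocks of `λ - μ`. -/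
def rowBlock (r : Fin (skewSize lam mu)) : ℕ := (rowRead (skewCells lam mu) r).1.1

/-- The column of the `r`-th box in the column reading of `λ/μ`: the blocks of `λ' - μ'`. -/
def colBlock (r : Fin (skewSize lam mu)) : ℕ := (colRead (skewCells lam mu) r).1.2

/-- The permutation `σ_{λ'/μ'}`: it sends the number of a box in the column reading of `λ/μ` (the
row reading of `λ'/μ'`) to its number in the row reading of `λ/μ`. -/
def sigmaConj : Equiv.Perm (Fin (skewSize lam mu)) :=
  (colRead (skewCells lam mu)).trans (rowRead (skewCells lam mu)).symm

variable (k : Type u) [Field k]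

/-- `Γ_Π^{λ/μ}`. -/
abbrev gammaShape : PolI k (skewSize lam mu) := gammaPi k (rowBlock lam mu)

/-- `S^{λ'/μ'}`. -/
abbrev symShapeConj : PolI k (skewSize lam mu) := symPol k (colBlock lam mu)

/-- `θ̂_{λ'/μ'} : Γ_Π^{λ/μ} → I^{⊗d} → I^{⊗d} → S^{λ'/μ'}`. -/
def thetaConj : EvenTrans (gammaShape lam mu k) (symShapeConj lam mu k) :=
  (symMul k (colBlock lam mu)).comp
    ((actTrans k (sigmaConj lam mu)).comp (deltaPi k (rowBlock lam mu)))

/-- The Schur superfunctor `Ŝ_{λ'/μ'}`, the image of `θ̂_{λ'/μ'}`. -/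
abbrev schurConj : PolI k (skewSize lam mu) := (thetaConj lam mu k).image.toPol

/-- The blocks of the source
`⋯ ⊗ Γ_Π^u ⊗ Γ_Π^{p₁-u+p₂-v} ⊗ Γ_Π^v ⊗ ⋯` of `◇_i(λ/μ, u, v)`, where `p₁` and `p₂` are the
lengths of the rows `i` and `i+1` of `λ/μ`: the first `u` places of row `i`, the last `v` places
of row `i+1`, all other places of these two rows together, and every other row. -/
def diamondBlock (i u v : ℕ) (r : Fin (skewSize lam mu)) : ℕ × ℕ :=
  let c := (rowRead (skewCells lam mu) r).1
  if c.1 = i then (if c.2 < mu.rowLen i + u then (i, 0) else (i, 1))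
  else if c.1 = i + 1 then (if lam.rowLen (i + 1) ≤ c.2 + v then (i, 2) else (i, 1))
  else (c.1, 0)

/-- The blocks of the middle term
`⋯ ⊗ Γ_Π^u ⊗ Γ_Π^{p₁-u} ⊗ Γ_Π^{p₂-v} ⊗ Γ_Π^v ⊗ ⋯`. -/
def diamondFine (i u v : ℕ) (r : Fin (skewSize lam mu)) : ℕ × (ℕ × ℕ) :=
  (rowBlock lam mu r, diamondBlock lam mu i u v r)

/-- `◇_i(λ/μ, u, v)`, tensored with the identity on the other rows: the composite
`(m ⊗ m) ∘ (1 ⊗ Δ ⊗ 1)`. -/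
def diamond (i u v : ℕ) :
    EvenTrans (gammaPi k (diamondBlock lam mu i u v)) (gammaShape lam mu k) :=
  (gammaMul k (diamondFine lam mu i u v) (rowBlock lam mu)).comp
    (gammaComul k (diamondBlock lam mu i u v) (diamondFine lam mu i u v)
      fun _ hσ r => congrArg Prod.snd (hσ r))

/-- `Im ◇_{λ/μ}`: the map `◇_{λ/μ}` is the sum of the maps `◇_i(λ/μ, u, v)` with
`u + v < λ_{i+1} - μ_i`, defined on the direct sum of their sources. -/
def imDiamond : SubPol (gammaShape lam mu k) :=
  SubPol.iSup fun p : {p : ℕ × ℕ × ℕ // p.2.1 + p.2.2 + mu.rowLen p.1 < lam.rowLen (p.1 + 1)} =>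
    (diamond lam mu k p.1.1 p.1.2.1 p.1.2.2).image

/-- A tableau of shape `λ/μ` with values in `[N]`. -/
abbrev Tableau (N : ℕ) : Type := skewCells lam mu → Fin N

variable {lam mu} {N : ℕ}

/-- The rows are nondecreasing, and repeated entries of a row are odd. -/
def RowCostandard (p : Fin N → ZMod 2) (t : Tableau lam mu N) : Prop :=
  ∀ a b : skewCells lam mu, a.1.1 = b.1.1 → a.1.2 < b.1.2 →
    t a ≤ t b ∧ (t a = t b → p (t a) = 1)

/-- The columns are nondecreasing, and repeated entries of a column are even. -/
def ColCostandard (p : Fin N → ZMod 2) (t : Tableau lam mu N) : Prop :=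
  ∀ a b : skewCells lam mu, a.1.2 = b.1.2 → a.1.1 < b.1.1 →
    t a ≤ t b ∧ (t a = t b → p (t a) = 0)

/-- The costandard tableaux of shape `λ/μ`. -/
abbrev CostandardTableau (lam mu : YoungDiagram) (p : Fin N → ZMod 2) : Type :=
  {t : Tableau lam mu N // RowCostandard p t ∧ ColCostandard p t}

/-- The reading word of a tableau. -/
def word (t : Tableau lam mu N) (r : Fin (skewSize lam mu)) : Fin N :=
  t (rowRead (skewCells lam mu) r)

/-- The blocks of equal entries in the rows of a tableau. -/
def entryBlock (t : Tableau lam mu N) (r : Fin (skewSize lam mu)) : ℕ × Fin N :=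
  (rowBlock lam mu r, word t r)

theorem rowRead_lt (s : Finset (ℕ × ℕ)) {r r' : Fin s.card} (h : r < r') :
    (rowRead s r).1.1 < (rowRead s r').1.1 ∨
      (rowRead s r).1.1 = (rowRead s r').1.1 ∧ (rowRead s r).1.2 < (rowRead s r').1.2 := by
  have h1 := ((s.map (toLex (α := ℕ × ℕ)).toEmbedding).orderIsoOfFin
    (Finset.card_map _)).strictMono h
  exact Prod.Lex.lt_iff.1 (show toLex (rowRead s r).1 < toLex (rowRead s r').1 from h1)

theorem koszulSign_eq_sign {p : Fin N → ZMod 2} {t : Tableau lam mu N} (ht : RowCostandard p t)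
    {σ : Equiv.Perm (Fin (skewSize lam mu))} (hσ : σ ∈ youngSubgroup (entryBlock t)) :
    koszulSign (fun r => p (word t r)) σ = Equiv.Perm.sign σ := by
  rw [← Equiv.Perm.sign_inv, Equiv.Perm.sign_eq_prod_prod_Iio, koszulSign]
  refine Finset.prod_congr rfl fun b _ => Finset.prod_congr rfl fun a hab => ?_
  have hab : a < b := by simpa using hab
  have hne : σ⁻¹ a ≠ σ⁻¹ b := fun e => hab.ne (σ⁻¹.injective e)
  rcases lt_or_gt_of_ne hne with h | h
  · rw [if_neg h.not_gt, if_pos h]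
  · rw [if_pos h, if_neg h.not_gt]
    have ha : entryBlock t (σ⁻¹ a) = entryBlock t a := (youngSubgroup _).inv_mem hσ a
    have hb : entryBlock t (σ⁻¹ b) = entryBlock t b := (youngSubgroup _).inv_mem hσ b
    have h1 := rowRead_lt _ hab
    have h2 := rowRead_lt _ h
    simp only [entryBlock, Prod.mk.injEq, rowBlock] at ha hb
    rw [ha.1, hb.1] at h2
    have hrow : (rowRead (skewCells lam mu) a).1.1 = (rowRead (skewCells lam mu) b).1.1 := by
      omega
    have hcol : (rowRead (skewCells lam mu) a).1.2 < (rowRead (skewCells lam mu) b).1.2 := by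
      omega
    have hcol2 : (rowRead (skewCells lam mu) (σ⁻¹ b)).1.2 <
        (rowRead (skewCells lam mu) (σ⁻¹ a)).1.2 := by
      omega
    have e1 := ht _ _ hrow hcol
    have e2 := (ht _ _ (by rw [ha.1, hb.1, hrow]) hcol2).1
    have e3 : word t b ≤ word t a := by rw [← ha.2, ← hb.2]; exact e2
    have e4 : word t a = word t b := le_antisymm e1.1 e3
    have e5 : p (word t a) = 1 := e1.2 e4
    rw [← e4, e5]
    decide

variable {k}

/-- For a basis `Z` of `M` with `Z_i ∈ M_{p i}`, the tensor `Z^t = Z_{w_1} ⊗ ⋯ ⊗ Z_{w_d}`, where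
`w` is the reading word of `t`. -/
def zTensor {M : SVec k} (Z : Module.Basis (Fin N) k M) (t : Tableau lam mu N) :
    tpow M (skewSize lam mu) :=
  PiTensorProduct.tprod k fun r => Z (word t r)

theorem zTensor_mem {M : SVec k} (Z : Module.Basis (Fin N) k M) {p : Fin N → ZMod 2}
    (hZ : ∀ i, Z i ∈ M.part (p i)) {t : Tableau lam mu N} (ht : RowCostandard p t) :
    zTensor Z t ∈ gammaPiSpace M (entryBlock t) := by
  intro σ hσ
  rw [zTensor, superAct_tprod M σ (p := fun r => p (word t r)) (fun r => hZ _),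
    koszulSign_eq_sign ht hσ]
  congr 2
  funext r
  have h : word t (σ r) = word t r := congrArg Prod.snd (hσ r)
  rw [h]

/-- For a row costandard tableau `t`, the element `Z_Π^{(t)} = Z_Π^{(t^1)} ⊗ Z_Π^{(t^2)} ⊗ ⋯` of
`Γ_Π^{λ/μ} M`. The factor of the row `i` is the product, in the divided powers superalgebra, of the
divided powers `(ΠZ_s)^{(a_s)}`, where `a_s` counts the entries `s` in that row; and
`(ΠZ_s)^{(a)}` is the tensor `Z_s ⊗ ⋯ ⊗ Z_s`. -/
def zPi {M : SVec k} (Z : Module.Basis (Fin N) k M) {p : Fin N → ZMod 2}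
    (hZ : ∀ i, Z i ∈ M.part (p i)) (t : Tableau lam mu N) (ht : RowCostandard p t) :
    (gammaShape lam mu k).obj M :=
  (gammaMul k (entryBlock t) (rowBlock lam mu)).app M ⟨zTensor Z t, zTensor_mem Z hZ ht⟩

end Shapes

end SchurSuper

end

noncomputable section

namespace SchurSuper

/-! ### Signs -/

section Signs

variable {d : ℕ}

/-! Fix a homogeneous basis of `M` and expand tensors in words. An element of `Γ_Π^α` is determined
by its coefficients on words sorted inside the blocks, and only odd letters may repeat in a block;
so the products of divided powers `divPow` of such words span (`mem_span_divPow`). For the rows of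
`λ/μ` these words are the row costandard tableaux. Three facts then give both claims.

Relations (`imDiamond_le_ker`). Each term of the coset sum defining `◇_i(λ/μ, u, v)` permutes places
inside rows. Rows `i` and `i + 1` share more than `u + v` columns, so by pigeonhole some column has
both of its boxes in the middle block. The tensor is antisymmetric in these two boxes, while
`S^{λ'/μ'}` makes them symmetric; twice the term dies, hence the term, as the characteristic is not
2.

Straightening (`span_costandard_sup_imDiamond`). If a row costandard tableau violates the column
condition, take an adjacent pair `x` above `y` in a column with `y < x`, or with `x = y` odd. Choose
`u` and `v` so that the middle block has entries `≥ x` in the upper row and `≤ y` in the lower one.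
Redistributing the block between the two rows can only increase the weight `∑ row · letter`, and a
tie means that only letters `x` changed rows. So `◇` produces the given element with coefficient 1,
up to terms of larger weight. Weights are bounded, so costandard elements and `Im ◇` together span.

Independence (`linearIndependent_theta_zPi`). In a column only even letters repeat, so reading off
the coefficient of a column word is well defined on coinvariants. By the rearrangement inequality
(`weight_colBlock_le`) a sorted row has the strictly largest `∑ column · letter` among the
rearrangements of its word. This makes the matrix of these coefficients on the elements
`θ̂(Z_Π^{(t)})` triangular with diagonal entries `±1`.

The first two facts show that the images of the costandard elements span; with the third, no nonzero
combination of costandard elements is killed by `θ̂`, so its kernel is exactly `Im ◇`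
(`ker_thetaConj`). -/

theorem koszulSign_one (p : Fin d → ZMod 2) : koszulSign p 1 = 1 := by
  refine Finset.prod_eq_one fun t _ => Finset.prod_eq_one fun s hs => if_neg ?_
  simpa using (Finset.mem_Iio.1 hs).le

/-- The sign of a conjugate of a permutation that preserves the parities. -/
theorem koszulSign_conj (p : Fin d → ZMod 2) (σ τ : Equiv.Perm (Fin d))
    (h : ∀ i, p (τ (σ i)) = p (τ i)) :
    koszulSign p (τ * σ * τ⁻¹) = koszulSign (fun i => p (τ i)) σ := by
  have h1 := koszulSign_mul p τ τ⁻¹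
  rw [mul_inv_cancel, koszulSign_one] at h1
  rw [koszulSign_mul, koszulSign_mul]
  simp only [Equiv.Perm.mul_apply, h]
  rw [mul_right_comm, ← h1, one_mul]

/-- Conjugation reduces this to the transposition of the first two places, which inverts a single
pair. Equal parities at `a` and `b` are what makes the conjugation formula applicable. -/
theorem koszulSign_swap {p : Fin d → ZMod 2} {a b : Fin d} (hab : a ≠ b) (hp : p a = p b) :
    koszulSign p (Equiv.swap a b) = (-1) ^ (p a).val := by
  -- Two distinct places force `d ≥ 2`, so that `0` and `1` are places.
  obtain ⟨n, rfl⟩ : ∃ n, d = n + 2 := by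
    refine ⟨d - 2, ?_⟩
    have := a.2; have := b.2; have := Fin.val_ne_of_ne hab; omega
  obtain ⟨τ, hτ⟩ := isConj_iff.1 (Equiv.Perm.isConj_swap (show (0 : Fin (n + 2)) ≠ 1 by simp) hab)
  have hs : Equiv.swap (τ 0) (τ 1) = Equiv.swap a b := by
    rw [← hτ, Equiv.swap_apply_apply]
  have hτ' : (τ 0 = a ∧ τ 1 = b) ∨ (τ 0 = b ∧ τ 1 = a) := by
    have h1 : Equiv.swap a b (τ 0) = τ 1 := by rw [← hs, Equiv.swap_apply_left]
    have hne : τ 0 ≠ τ 1 := fun e => by simpa using τ.injective e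
    by_cases ha : τ 0 = a
    · left; rw [ha, Equiv.swap_apply_left] at h1; exact ⟨ha, h1.symm⟩
    · by_cases hb : τ 0 = b
      · right; rw [hb, Equiv.swap_apply_right] at h1; exact ⟨hb, h1.symm⟩
      · rw [Equiv.swap_apply_of_ne_of_ne ha hb] at h1; exact absurd h1 hne
  have e0 : p (τ 0) = p a := by rcases hτ' with h | h <;> simp [h, hp]
  have e1 : p (τ 1) = p a := by rcases hτ' with h | h <;> simp [h, hp]
  have hinv : ∀ i, p (τ (Equiv.swap 0 1 i)) = p (τ i) := by
    intro i
    by_cases h0 : i = 0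
    · rw [h0, Equiv.swap_apply_left, e0, e1]
    · by_cases h1 : i = 1
      · rw [h1, Equiv.swap_apply_right, e0, e1]
      · rw [Equiv.swap_apply_of_ne_of_ne h0 h1]
  rw [← hτ, koszulSign_conj p _ _ hinv, koszulSign]
  have hval : ∀ i : Fin (n + 2), ((Equiv.swap 0 1 : Equiv.Perm (Fin (n + 2)))⁻¹ i).val =
      if i.val = 0 then 1 else if i.val = 1 then 0 else i.val := by
    intro i
    rw [Equiv.swap_inv, Equiv.swap_apply_def]
    simp only [Fin.ext_iff, Fin.val_zero, Fin.val_one]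
    split_ifs <;> simp
  have key : ∀ s t : Fin (n + 2), s < t →
      ((Equiv.swap 0 1 : Equiv.Perm (Fin (n + 2)))⁻¹ t < (Equiv.swap 0 1)⁻¹ s ↔ t = 1 ∧ s = 0) := by
    intro s t hst
    rw [Fin.lt_def] at hst
    rw [Fin.lt_def, hval, hval, Fin.ext_iff, Fin.ext_iff, Fin.val_one, Fin.val_zero]
    split_ifs <;> omega
  rw [Finset.prod_eq_single 1, Finset.prod_eq_single 0]
  · rw [if_pos ((key 0 1 (by simp)).2 ⟨rfl, rfl⟩), e0, e1]
    generalize p a = ε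
    rcases zmod2_cases ε with rfl | rfl <;> rfl
  · intro s hs hs0
    exact if_neg fun h => hs0 ((key _ _ (Finset.mem_Iio.1 hs)).1 h).2
  · intro h; exact absurd (Finset.mem_Iio.2 (by simp)) h
  · intro t _ ht
    exact Finset.prod_eq_one fun s hs => if_neg fun h => ht ((key _ _ (Finset.mem_Iio.1 hs)).1 h).1
  · simp

variable {β : Type}

theorem swap_mem_youngSubgroup {b : Fin d → β} {x y : Fin d} (h : b x = b y) :
    Equiv.swap x y ∈ youngSubgroup b := by
  intro r
  rw [Equiv.swap_apply_def]
  split_ifs with h1 h2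
  · rw [h1, h]
  · rw [h2, h]
  · rfl

/-- Young subgroups are generated by transpositions. -/
theorem youngSubgroup_induction {b : Fin d → β} {P : Equiv.Perm (Fin d) → Prop} (h1 : P 1)
    (hswap : ∀ (x y : Fin d) (σ : Equiv.Perm (Fin d)), x ≠ y → b x = b y →
      σ ∈ youngSubgroup b → P σ → P (Equiv.swap x y * σ))
    {σ : Equiv.Perm (Fin d)} (hσ : σ ∈ youngSubgroup b) : P σ := by
  induction hn : σ.support.card using Nat.strong_induction_on generalizing σ with
  | _ n ih =>
    by_cases hone : σ = 1
    · rwa [hone]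
    -- Multiplying by the transposition of `x` and `σ x` fixes `x` and shrinks the support; both
    -- points lie in one block.
    · obtain ⟨x, hx⟩ : ∃ x, σ x ≠ x := by
        by_contra! h
        exact hone (Equiv.ext h)
      have hs : Equiv.swap x (σ x) ∈ youngSubgroup b := swap_mem_youngSubgroup (hσ x).symm
      have h := hswap x (σ x) _ hx.symm (hσ x).symm ((youngSubgroup b).mul_mem hs hσ)
        (ih _ (by rw [← hn]; exact Equiv.Perm.card_support_swap_mul hx)
          ((youngSubgroup b).mul_mem hs hσ) rfl)
      rwa [← mul_assoc, Equiv.swap_mul_self, one_mul] at h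

variable {N : ℕ}

/-- The blocks of equal letters of a word inside the blocks of `b`. -/
abbrev letterBlock (b : Fin d → β) (w : Fin d → Fin N) (r : Fin d) : β × Fin N := (b r, w r)

/-- A letter that is repeated in a block of `b` has parity `ε`. -/
def RepeatsIn (ε : ZMod 2) (p : Fin N → ZMod 2) (b : Fin d → β) (w : Fin d → Fin N) : Prop :=
  ∀ x y, x ≠ y → b x = b y → w x = w y → p (w x) = ε

theorem word_comp_of_mem {b : Fin d → β} {w : Fin d → Fin N} {σ : Equiv.Perm (Fin d)}
    (hσ : σ ∈ youngSubgroup (letterBlock b w)) : w ∘ σ = w :=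
  funext fun r => congrArg Prod.snd (hσ r)

theorem mem_letterBlock {b : Fin d → β} {w : Fin d → Fin N} {σ : Equiv.Perm (Fin d)}
    (hσ : σ ∈ youngSubgroup b) (h : w ∘ σ = w) : σ ∈ youngSubgroup (letterBlock b w) :=
  fun r => Prod.ext (hσ r) (congrFun h r)

theorem koszulSign_swap_mul_letterBlock {ε : ZMod 2} {p : Fin N → ZMod 2} {b : Fin d → β}
    {w : Fin d → Fin N} (hw : RepeatsIn ε p b w) {x y : Fin d} (σ : Equiv.Perm (Fin d))
    (hxy : x ≠ y) (h : letterBlock b w x = letterBlock b w y) :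
    koszulSign (p ∘ w) (Equiv.swap x y * σ) = (-1) ^ ε.val * koszulSign (p ∘ w) σ := by
  have hwxy : w x = w y := congrArg Prod.snd h
  rw [koszulSign_mul, koszulSign_swap hxy (by simp [hwxy]), Function.comp_apply,
    hw x y hxy (congrArg Prod.fst h) hwxy]
  congr 2
  exact funext fun i => congrArg p (congrArg Prod.snd (swap_mem_youngSubgroup h i))

/-- Every transposition of equal odd letters contributes `-1`. Neither sortedness of the word nor
blocks that are rows is assumed: the middle blocks of `◇` span two rows. -/
theorem koszulSign_eq_sign_of_repeatsIn {p : Fin N → ZMod 2} {b : Fin d → β} {w : Fin d → Fin N}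
    (hw : RepeatsIn 1 p b w) {σ : Equiv.Perm (Fin d)}
    (hσ : σ ∈ youngSubgroup (letterBlock b w)) :
    koszulSign (p ∘ w) σ = Equiv.Perm.sign σ := by
  refine youngSubgroup_induction (P := fun σ => koszulSign (p ∘ w) σ = Equiv.Perm.sign σ)
    (by simp [koszulSign_one]) ?_ hσ
  intro x y σ hxy h _ ih
  rw [koszulSign_swap_mul_letterBlock hw σ hxy h, ih, Equiv.Perm.sign_mul,
    Equiv.Perm.sign_swap hxy]
  rfl

/-- Even letters commute without sign; this is the case of the columns. -/
theorem koszulSign_eq_one_of_repeatsIn {p : Fin N → ZMod 2} {b : Fin d → β} {w : Fin d → Fin N}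
    (hw : RepeatsIn 0 p b w) {σ : Equiv.Perm (Fin d)}
    (hσ : σ ∈ youngSubgroup (letterBlock b w)) :
    koszulSign (p ∘ w) σ = 1 := by
  refine youngSubgroup_induction (P := fun σ => koszulSign (p ∘ w) σ = 1)
    (koszulSign_one _) ?_ hσ
  intro x y σ hxy h _ ih
  rw [koszulSign_swap_mul_letterBlock hw σ hxy h, ih]
  rfl

theorem units_cast_ne_zero {k : Type u} [Field k] (e : ℤˣ) : ((e : ℤ) : k) ≠ 0 := by
  rcases Int.units_eq_one_or e with rfl | rfl <;> simp

end Signs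

/-! ### Coefficients of tensors with respect to words -/

section Words

variable {k : Type u} [Field k] {d N : ℕ} {β γ : Type} {M : SVec k}

/-- The basis of `M^{⊗d}` formed by the tensors `Z_{w_1} ⊗ ⋯ ⊗ Z_{w_d}`. -/
def wordBasis (d : ℕ) (Z : Module.Basis (Fin N) k M) :
    Module.Basis (Fin d → Fin N) k (tpow M d) :=
  Basis.piTensorProduct (fun _ : Fin d => Z)

theorem wordBasis_apply (Z : Module.Basis (Fin N) k M) (w : Fin d → Fin N) :
    wordBasis d Z w = PiTensorProduct.tprod k fun r => Z (w r) :=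
  Basis.piTensorProduct_apply _ _

/-- The coefficient of a word in a tensor. -/
def coeff (Z : Module.Basis (Fin N) k M) (w : Fin d → Fin N) : tpow M d →ₗ[k] k :=
  (wordBasis d Z).coord w

theorem coeff_wordBasis (Z : Module.Basis (Fin N) k M) (w w' : Fin d → Fin N) :
    coeff Z w (wordBasis d Z w') = if w' = w then 1 else 0 := by
  rw [coeff, Module.Basis.coord_apply, Module.Basis.repr_self, Finsupp.single_apply]

theorem tensor_ext (Z : Module.Basis (Fin N) k M) {x y : tpow M d}
    (h : ∀ w, coeff Z w x = coeff Z w y) : x = y :=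
  (wordBasis d Z).ext_elem h

theorem sum_coeff (Z : Module.Basis (Fin N) k M) (x : tpow M d) :
    ∑ w, coeff Z w x • wordBasis d Z w = x :=
  (wordBasis d Z).sum_repr x

variable {Z : Module.Basis (Fin N) k M} {p : Fin N → ZMod 2}

theorem superAct_wordBasis (hZ : ∀ i, Z i ∈ M.part (p i)) (σ : Equiv.Perm (Fin d))
    (w : Fin d → Fin N) :
    superAct M σ (wordBasis d Z w) =
      ((koszulSign (p ∘ w) σ : ℤ) : k) • wordBasis d Z (w ∘ σ) := by
  rw [wordBasis_apply, wordBasis_apply, superAct_tprod M σ (p := p ∘ w) fun r => hZ _]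
  rfl

theorem superAct_one (y : tpow M d) : superAct M 1 y = y := by
  induction y using tpow_induction M with
  | h p x hx => simp [superAct_tprod M 1 hx, koszulSign_one]
  | hadd x y hx hy => rw [map_add, hx, hy]
  | hsmul a x hx => rw [map_smul, hx]

theorem coeff_superAct (hZ : ∀ i, Z i ∈ M.part (p i)) (σ : Equiv.Perm (Fin d))
    (w : Fin d → Fin N) (y : tpow M d) :
    coeff Z (w ∘ σ) (superAct M σ y) = ((koszulSign (p ∘ w) σ : ℤ) : k) * coeff Z w y := by
  have h : coeff Z (w ∘ σ) ∘ₗ superAct M σ = ((koszulSign (p ∘ w) σ : ℤ) : k) • coeff Z w := by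
    refine (wordBasis d Z).ext fun v => ?_
    rw [LinearMap.comp_apply, superAct_wordBasis hZ, map_smul, LinearMap.smul_apply,
      coeff_wordBasis, coeff_wordBasis]
    have e : v ∘ σ = w ∘ σ ↔ v = w := σ.surjective.right_cancellable
    by_cases hv : v = w
    · simp [hv]
    · rw [if_neg hv, if_neg fun h => hv (e.1 h), smul_zero, smul_zero]
  exact LinearMap.congr_fun h y

theorem coeff_superAct_inv (hZ : ∀ i, Z i ∈ M.part (p i)) (σ : Equiv.Perm (Fin d))
    (w : Fin d → Fin N) (y : tpow M d) :
    coeff Z w (superAct M σ⁻¹ y) =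
      ((koszulSign (p ∘ w ∘ σ) σ⁻¹ : ℤ) : k) * coeff Z (w ∘ σ) y := by
  have h := coeff_superAct hZ σ⁻¹ (w ∘ σ) y
  have e : (w ∘ σ) ∘ (σ⁻¹ : Equiv.Perm (Fin d)) = w := by
    funext r; simp
  rwa [e] at h

/-- Along an orbit of the Young subgroup the coefficients change only by signs, so vanishing may be
tested on one representative. -/
theorem coeff_comp_eq_zero_iff (hZ : ∀ i, Z i ∈ M.part (p i)) {b : Fin d → β} {y : tpow M d}
    (hy : y ∈ gammaPiSpace M b) {σ : Equiv.Perm (Fin d)} (hσ : σ ∈ youngSubgroup b)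
    (w : Fin d → Fin N) : coeff Z (w ∘ σ) y = 0 ↔ coeff Z w y = 0 := by
  have h := coeff_superAct hZ σ w y
  rw [hy σ hσ, map_smul, smul_eq_mul] at h
  constructor
  · intro h0
    rw [h0, mul_zero] at h
    exact (mul_eq_zero.1 h.symm).resolve_left (units_cast_ne_zero _)
  · intro h0
    rw [h0, mul_zero] at h
    exact (mul_eq_zero.1 h).resolve_left (units_cast_ne_zero _)

/-- A tensor in `Γ_Π^α` involves no word with an even letter repeated in a block. -/
theorem coeff_eq_zero_of_repeat (hk : ringChar k ≠ 2) (hZ : ∀ i, Z i ∈ M.part (p i))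
    {b : Fin d → β} {y : tpow M d} (hy : y ∈ gammaPiSpace M b) {w : Fin d → Fin N}
    (hw : ¬ RepeatsIn 1 p b w) : coeff Z w y = 0 := by
  simp only [RepeatsIn, not_forall] at hw
  obtain ⟨r, s, hrs, hb, hwrs, hp⟩ := hw
  have hp0 : p (w r) = 0 := (zmod2_cases _).resolve_right hp
  have h := coeff_superAct hZ (Equiv.swap r s) w y
  have e : w ∘ Equiv.swap r s = w :=
    word_comp_of_mem (b := b) (swap_mem_youngSubgroup (Prod.ext hb hwrs))
  rw [hy _ (swap_mem_youngSubgroup hb), e, map_smul, Equiv.Perm.sign_swap hrs,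
    koszulSign_swap hrs (by simp [hwrs])] at h
  simp only [Function.comp_apply, hp0, ZMod.val_zero, pow_zero, Units.val_one, Int.cast_one,
    one_mul, Units.val_neg, Int.cast_neg, neg_smul, one_smul] at h
  -- The word is fixed by the transposition with sign `+1`, whereas the tensor changes sign.
  have h2 : (2 : k) * coeff Z w y = 0 := by linear_combination -h
  exact (mul_eq_zero.1 h2).resolve_left (Ring.two_ne_zero hk)

theorem exists_coeff_ne_zero_of_cosetSum (hZ : ∀ i, Z i ∈ M.part (p i)) (f : Fin d → γ)
    (b : Fin d → β) {y : tpow M d} {w : Fin d → Fin N} (h : coeff Z w (cosetSum M f b y) ≠ 0) :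
    ∃ σ ∈ youngSubgroup b, coeff Z (w ∘ σ) y ≠ 0 := by
  classical
  by_contra! h0
  refine h ?_
  simp only [cosetSum, LinearMap.sum_apply, LinearMap.smul_apply, map_sum, map_smul]
  refine Finset.sum_eq_zero fun q _ => ?_
  rw [coeff_superAct_inv hZ, h0 _ (q.out).2, mul_zero, smul_zero]

/-- The hypothesis says that only the trivial coset can carry `w` into the support of `y`. -/
theorem coeff_cosetSum (hZ : ∀ i, Z i ∈ M.part (p i)) (f : Fin d → γ) (b : Fin d → β)
    {y : tpow M d} (hy : y ∈ gammaPiSpace M f) {w : Fin d → Fin N}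
    (h : ∀ σ ∈ youngSubgroup b, coeff Z (w ∘ σ) y ≠ 0 → σ ∈ youngSubgroup f) :
    coeff Z w (cosetSum M f b y) = coeff Z w y := by
  classical
  simp only [cosetSum, LinearMap.sum_apply, LinearMap.smul_apply, map_sum]
  rw [Finset.sum_eq_single
    (QuotientGroup.mk 1 : youngSubgroup b ⧸ (youngSubgroup f).subgroupOf (youngSubgroup b))]
  · rw [coset_term_eq M f b hy (h := 1) (QuotientGroup.out_eq' _)]
    simp only [Subgroup.coe_one, Equiv.Perm.sign_one, Units.val_one, Int.cast_one, one_smul,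
      inv_one]
    rw [superAct_one]
  · intro q _ hq
    rw [map_smul, coeff_superAct_inv hZ]
    by_cases h0 : coeff Z (w ∘ (q.out : Equiv.Perm (Fin d))) y = 0
    · rw [h0, mul_zero, smul_zero]
    · refine absurd ?_ hq
      rw [← QuotientGroup.out_eq' q]
      refine QuotientGroup.eq.2 ?_
      rw [Subgroup.mem_subgroupOf]
      simpa using h _ (q.out).2 h0
  · simp

/-- The product over the blocks of `b` of the divided powers of the letters of `w`. -/
def divPow (Z : Module.Basis (Fin N) k M) (b : Fin d → β) (w : Fin d → Fin N) : tpow M d :=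
  cosetSum M (letterBlock b w) b (wordBasis d Z w)

theorem wordBasis_mem (hZ : ∀ i, Z i ∈ M.part (p i)) {b : Fin d → β} {w : Fin d → Fin N}
    (hw : RepeatsIn 1 p b w) : wordBasis d Z w ∈ gammaPiSpace M (letterBlock b w) := by
  intro σ hσ
  rw [superAct_wordBasis hZ, koszulSign_eq_sign_of_repeatsIn hw hσ, word_comp_of_mem hσ]

theorem divPow_mem (hZ : ∀ i, Z i ∈ M.part (p i)) {b : Fin d → β} {w : Fin d → Fin N}
    (hw : RepeatsIn 1 p b w) : divPow Z b w ∈ gammaPiSpace M b :=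
  cosetSum_mem M _ b (wordBasis_mem hZ hw)

theorem exists_of_coeff_divPow_ne_zero (hZ : ∀ i, Z i ∈ M.part (p i)) {b : Fin d → β}
    {w v : Fin d → Fin N} (h : coeff Z v (divPow Z b w) ≠ 0) :
    ∃ σ ∈ youngSubgroup b, v = w ∘ σ := by
  obtain ⟨σ, hσ, h0⟩ := exists_coeff_ne_zero_of_cosetSum hZ _ b h
  have e : w = v ∘ σ := by
    by_contra hne
    exact h0 (by rw [coeff_wordBasis, if_neg hne])
  refine ⟨σ⁻¹, (youngSubgroup b).inv_mem hσ, ?_⟩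
  rw [e]; funext r; simp

/-- The sum runs over cosets of the stabilizer of the word, so the word occurs once and not as often
as the stabilizer has elements. -/
theorem coeff_divPow_self (hZ : ∀ i, Z i ∈ M.part (p i)) {b : Fin d → β} {w : Fin d → Fin N}
    (hw : RepeatsIn 1 p b w) : coeff Z w (divPow Z b w) = 1 := by
  rw [divPow, coeff_cosetSum hZ _ b (wordBasis_mem hZ hw), coeff_wordBasis, if_pos rfl]
  intro σ hσ h
  refine mem_letterBlock hσ ?_
  by_contra hne
  exact h (by rw [coeff_wordBasis, if_neg (Ne.symm hne)])

end Words

/-! ### The relations `◇` lie in the kernel of `θ̂` -/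

section Relations

variable {k : Type u} [Field k] {d : ℕ} {β γ : Type}

/-- Swapping `r` and `s` after `τ` is swapping `τ r` and `τ s` before it, which changes the sign of
`y`. Modulo the kernel the same swap acts trivially, so twice the tensor lies in the kernel. -/
theorem superAct_mem_symKer_of_swap (hk : ringChar k ≠ 2) {M : SVec k} {b : Fin d → β}
    {c : Fin d → γ} {y : tpow M d} (hy : y ∈ gammaPiSpace M b) (τ : Equiv.Perm (Fin d))
    {r s : Fin d} (hrs : r ≠ s) (hc : c r = c s) (hb : b (τ r) = b (τ s)) :
    superAct M τ y ∈ symKerSpace M c := by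
  have h : superAct M (Equiv.swap r s) (superAct M τ y) = - superAct M τ y := by
    rw [superAct_superAct, Equiv.mul_swap_eq_swap_mul, ← superAct_superAct,
      hy _ (swap_mem_youngSubgroup hb), Equiv.Perm.sign_swap fun e => hrs (τ.injective e)]
    simp
  have h1 : superAct M (Equiv.swap r s) (superAct M τ y) - superAct M τ y ∈ symKerSpace M c :=
    Submodule.subset_span ⟨_, swap_mem_youngSubgroup hc, _, rfl⟩
  have h2 : superAct M τ y = (-(2 : k)⁻¹) •
      (superAct M (Equiv.swap r s) (superAct M τ y) - superAct M τ y) := by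
    have h3 : (2 : k)⁻¹ * 2 = 1 := inv_mul_cancel₀ (Ring.two_ne_zero hk)
    rw [h, ← neg_add', smul_neg, neg_smul, neg_neg, ← two_smul k, smul_smul, h3, one_smul]
  rw [h2]
  exact Submodule.smul_mem _ _ h1

variable {lam mu : YoungDiagram}

theorem mem_skewCells {i c : ℕ} :
    (i, c) ∈ skewCells lam mu ↔ mu.rowLen i ≤ c ∧ c < lam.rowLen i := by
  rw [skewCells, Finset.mem_sdiff, YoungDiagram.mem_cells, YoungDiagram.mem_cells,
    YoungDiagram.mem_iff_lt_rowLen, YoungDiagram.mem_iff_lt_rowLen]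
  omega

/-- The column to which a permutation of the places moves the box `(i, c)`. -/
def movedCol (lam mu : YoungDiagram) (τ : Equiv.Perm (Fin (skewSize lam mu))) (i c : ℕ) : ℕ :=
  if h : (i, c) ∈ skewCells lam mu then
    (rowRead (skewCells lam mu) (τ ((rowRead (skewCells lam mu)).symm ⟨(i, c), h⟩))).1.2
  else 0

theorem rowRead_moved {τ : Equiv.Perm (Fin (skewSize lam mu))}
    (hτ : τ ∈ youngSubgroup (rowBlock lam mu)) {i c : ℕ} (h : (i, c) ∈ skewCells lam mu) :
    (rowRead (skewCells lam mu) (τ ((rowRead (skewCells lam mu)).symm ⟨(i, c), h⟩))).1 =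
      (i, movedCol lam mu τ i c) := by
  refine Prod.ext ?_ ?_
  · have := hτ ((rowRead (skewCells lam mu)).symm ⟨(i, c), h⟩)
    simpa [rowBlock] using this
  · simp [movedCol, h]

theorem movedCol_mem {τ : Equiv.Perm (Fin (skewSize lam mu))}
    (hτ : τ ∈ youngSubgroup (rowBlock lam mu)) {i c : ℕ} (h : (i, c) ∈ skewCells lam mu) :
    (i, movedCol lam mu τ i c) ∈ skewCells lam mu := by
  rw [← rowRead_moved hτ h]
  exact Subtype.coe_prop _

theorem movedCol_inj {τ : Equiv.Perm (Fin (skewSize lam mu))}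
    (hτ : τ ∈ youngSubgroup (rowBlock lam mu)) {i c c' : ℕ} (h : (i, c) ∈ skewCells lam mu)
    (h' : (i, c') ∈ skewCells lam mu) (e : movedCol lam mu τ i c = movedCol lam mu τ i c') :
    c = c' := by
  have h1 := rowRead_moved hτ h
  rw [e, ← rowRead_moved hτ h'] at h1
  have h2 := (rowRead (skewCells lam mu)).symm.injective
    (τ.injective ((rowRead (skewCells lam mu)).injective (Subtype.ext h1)))
  exact congrArg (fun x : skewCells lam mu => x.1.2) h2

/-- A permutation within the rows leaves two boxes of one column in the middle block. -/
theorem exists_column_in_middle {τ : Equiv.Perm (Fin (skewSize lam mu))}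
    (hτ : τ ∈ youngSubgroup (rowBlock lam mu)) {i u v : ℕ}
    (huv : u + v + mu.rowLen i < lam.rowLen (i + 1)) :
    ∃ (c : ℕ) (h : (i, c) ∈ skewCells lam mu) (h' : (i + 1, c) ∈ skewCells lam mu),
      diamondBlock lam mu i u v (τ ((rowRead (skewCells lam mu)).symm ⟨_, h⟩)) = (i, 1) ∧
      diamondBlock lam mu i u v (τ ((rowRead (skewCells lam mu)).symm ⟨_, h'⟩)) = (i, 1) := by
  have hlam := lam.rowLen_anti i (i + 1) (by omega)
  have hmu := mu.rowLen_anti i (i + 1) (by omega)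
  have m1 : ∀ c ∈ Finset.Ico (mu.rowLen i) (lam.rowLen (i + 1)), (i, c) ∈ skewCells lam mu := by
    intro c hc
    rw [Finset.mem_Ico] at hc
    rw [mem_skewCells]; omega
  have m2 : ∀ c ∈ Finset.Ico (mu.rowLen i) (lam.rowLen (i + 1)),
      (i + 1, c) ∈ skewCells lam mu := by
    intro c hc
    rw [Finset.mem_Ico] at hc
    rw [mem_skewCells]; omega
  -- Pigeonhole: by injectivity inside a row, at most `u` of the shared columns send their upper box
  -- to the first `u` places, and at most `v` send their lower box to the last `v`. There are more
  -- than `u + v` shared columns.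
  obtain ⟨c, hc, hc1, hc2⟩ : ∃ c ∈ Finset.Ico (mu.rowLen i) (lam.rowLen (i + 1)),
      mu.rowLen i + u ≤ movedCol lam mu τ i c ∧
      movedCol lam mu τ (i + 1) c + v < lam.rowLen (i + 1) := by
    by_contra! hno
    set I := Finset.Ico (mu.rowLen i) (lam.rowLen (i + 1)) with hI
    have c1 : (I.filter fun c => movedCol lam mu τ i c < mu.rowLen i + u).card ≤
        (Finset.Ico (mu.rowLen i) (mu.rowLen i + u)).card := by
      refine Finset.card_le_card_of_injOn (movedCol lam mu τ i) ?_ ?_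
      · intro c hc
        have hc := Finset.mem_filter.1 (Finset.mem_coe.1 hc)
        have := (mem_skewCells.1 (movedCol_mem hτ (m1 c hc.1))).1
        exact Finset.mem_coe.2 (Finset.mem_Ico.2 ⟨this, hc.2⟩)
      · intro c hc c' hc' e
        exact movedCol_inj hτ (m1 c (Finset.mem_filter.1 (Finset.mem_coe.1 hc)).1)
          (m1 c' (Finset.mem_filter.1 (Finset.mem_coe.1 hc')).1) e
    have c2 : (I.filter fun c => lam.rowLen (i + 1) ≤ movedCol lam mu τ (i + 1) c + v).card ≤
        (Finset.Ico (lam.rowLen (i + 1) - v) (lam.rowLen (i + 1))).card := by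
      refine Finset.card_le_card_of_injOn (movedCol lam mu τ (i + 1)) ?_ ?_
      · intro c hc
        have hc := Finset.mem_filter.1 (Finset.mem_coe.1 hc)
        have h1 := (mem_skewCells.1 (movedCol_mem hτ (m2 c hc.1))).2
        have h2 := hc.2
        exact Finset.mem_coe.2 (Finset.mem_Ico.2 ⟨by omega, h1⟩)
      · intro c hc c' hc' e
        exact movedCol_inj hτ (m2 c (Finset.mem_filter.1 (Finset.mem_coe.1 hc)).1)
          (m2 c' (Finset.mem_filter.1 (Finset.mem_coe.1 hc')).1) e
    have c3 : I ⊆ (I.filter fun c => movedCol lam mu τ i c < mu.rowLen i + u) ∪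
        (I.filter fun c => lam.rowLen (i + 1) ≤ movedCol lam mu τ (i + 1) c + v) := by
      intro c hc
      rw [Finset.mem_union, Finset.mem_filter, Finset.mem_filter]
      rcases lt_or_ge (movedCol lam mu τ i c) (mu.rowLen i + u) with h | h
      · exact Or.inl ⟨hc, h⟩
      · exact Or.inr ⟨hc, hno c hc h⟩
    have c4 := (Finset.card_le_card c3).trans (Finset.card_union_le _ _)
    rw [Nat.card_Ico] at c1 c2
    have c5 : I.card = lam.rowLen (i + 1) - mu.rowLen i := by rw [hI, Nat.card_Ico]
    omega
  refine ⟨c, m1 c hc, m2 c hc, ?_, ?_⟩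
  · simp only [diamondBlock, rowRead_moved hτ (m1 c hc), if_true]
    rw [if_neg (by omega)]
  · simp only [diamondBlock, rowRead_moved hτ (m2 c hc)]
    rw [if_neg (by omega), if_pos trivial, if_neg (by omega)]

theorem thetaConj_app_eq_zero_iff {M : SVec k} (x : (gammaShape lam mu k).obj M) :
    (thetaConj lam mu k).app M x = 0 ↔
      superAct M (sigmaConj lam mu) x.1 ∈ symKerSpace M (colBlock lam mu) :=
  Submodule.Quotient.mk_eq_zero _

theorem thetaConj_diamond (hk : ringChar k ≠ 2) {i u v : ℕ}
    (huv : u + v + mu.rowLen i < lam.rowLen (i + 1)) (M : SVec k)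
    (y : (gammaPi k (diamondBlock lam mu i u v)).obj M) :
    (thetaConj lam mu k).app M ((diamond lam mu k i u v).app M y) = 0 := by
  classical
  rw [thetaConj_app_eq_zero_iff]
  change superAct M (sigmaConj lam mu) (cosetSum M (diamondFine lam mu i u v) (rowBlock lam mu)
    y.1) ∈ _
  simp only [cosetSum, LinearMap.sum_apply, LinearMap.smul_apply, map_sum, map_smul]
  refine Submodule.sum_mem _ fun q _ => Submodule.smul_mem _ _ ?_
  rw [superAct_superAct]
  -- The representatives act through their inverses, so the pigeonhole argument is applied to the
  -- inverse, which also preserves rows.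
  obtain ⟨c, h, h', e, e'⟩ := exists_column_in_middle
    ((youngSubgroup (rowBlock lam mu)).inv_mem (q.out).2) huv
  refine superAct_mem_symKer_of_swap hk y.2 _
    (r := (colRead (skewCells lam mu)).symm ⟨_, h⟩)
    (s := (colRead (skewCells lam mu)).symm ⟨_, h'⟩) ?_ ?_ ?_
  · intro e
    simpa using (colRead (skewCells lam mu)).symm.injective e
  · simp [colBlock]
  · simp only [Equiv.Perm.mul_apply, sigmaConj, Equiv.trans_apply, Equiv.apply_symm_apply]
    rw [e, e']

theorem imDiamond_le_ker (hk : ringChar k ≠ 2) (M : SVec k) :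
    (imDiamond lam mu k).sub M ≤ LinearMap.ker ((thetaConj lam mu k).app M) := by
  refine iSup_le ?_
  rintro ⟨⟨i, u, v⟩, h⟩ _ ⟨y, rfl⟩
  exact thetaConj_diamond hk h M y

end Relations

/-! ### Sorted words and the standard spanning set of `Γ_Π^α` -/

section Sorted

variable {d N : ℕ}

/-- The letters of `w` are nondecreasing in each block of the nondecreasing function `b`. -/
def BlockSorted (b : Fin d → ℕ) (w : Fin d → Fin N) : Prop :=
  Monotone fun r => toLex (b r, w r)

/-- Sort the pairs (block, letter) lexicographically. The sorted block function is a monotone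
rearrangement of the already monotone `b`, hence equal to it, so the sorting permutation stays
inside the blocks. -/
theorem exists_blockSorted {b : Fin d → ℕ} (hb : Monotone b) (w : Fin d → Fin N) :
    ∃ σ ∈ youngSubgroup b, BlockSorted b (w ∘ σ) := by
  let f : Fin d → ℕ ×ₗ Fin N := fun r => toLex (b r, w r)
  have hm : Monotone (f ∘ Tuple.sort f) := Tuple.monotone_sort f
  have h1 : Monotone (b ∘ Tuple.sort f) := fun r s h => Prod.Lex.monotone_fst _ _ (hm h)
  have h2 : b ∘ Tuple.sort f = b ∘ (1 : Equiv.Perm (Fin d)) := Tuple.unique_monotone h1 hb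
  refine ⟨Tuple.sort f, fun r => congrFun h2 r, fun r s h => ?_⟩
  have h3 := hm h
  simp only [f, Function.comp_apply] at h3
  rwa [show b (Tuple.sort f r) = b r from congrFun h2 r,
    show b (Tuple.sort f s) = b s from congrFun h2 s] at h3

theorem BlockSorted.comp_eq {b : Fin d → ℕ} {w : Fin d → Fin N} (hw : BlockSorted b w)
    {σ : Equiv.Perm (Fin d)} (hσ : σ ∈ youngSubgroup b) (hwσ : BlockSorted b (w ∘ σ)) :
    w ∘ σ = w := by
  have h1 : Monotone ((fun r => toLex (b r, w r)) ∘ σ) := by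
    intro r s h
    have := hwσ h
    simp only [Function.comp_apply] at this ⊢
    rwa [hσ r, hσ s]
  have h2 := Tuple.unique_monotone (τ := 1) h1 hw
  exact funext fun r => congrArg (fun x => (ofLex x).2) (congrFun h2 r)

end Sorted

section Spanning

variable {k : Type u} [Field k] {d N : ℕ} {M : SVec k} {Z : Module.Basis (Fin N) k M}
  {p : Fin N → ZMod 2}

/-- Among sorted words, `divPow Z b w` has a coefficient only at `w`, where it is 1; so the
coefficients of `y` at sorted words are its coordinates. The predicate `Q` passes information on the
support of `y` to the words used in the expansion. -/
theorem mem_span_divPow (hk : ringChar k ≠ 2) (hZ : ∀ i, Z i ∈ M.part (p i)) {b : Fin d → ℕ}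
    (hb : Monotone b) {y : tpow M d} (hy : y ∈ gammaPiSpace M b) {Q : (Fin d → Fin N) → Prop}
    (hQ : ∀ w, coeff Z w y ≠ 0 → Q w) :
    y ∈ Submodule.span k
      {x | ∃ w, BlockSorted b w ∧ RepeatsIn 1 p b w ∧ Q w ∧ x = divPow Z b w} := by
  classical
  set S := Finset.univ.filter fun w : Fin d → Fin N => BlockSorted b w ∧ RepeatsIn 1 p b w with hS
  have hz : ∑ w ∈ S, coeff Z w y • divPow Z b w ∈ gammaPiSpace M b :=
    Submodule.sum_mem _ fun w hw =>
      Submodule.smul_mem _ _ (divPow_mem hZ (Finset.mem_filter.1 hw).2.2)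
  have key : y = ∑ w ∈ S, coeff Z w y • divPow Z b w := by
    have hyz := Submodule.sub_mem _ hy hz
    -- By symmetry the coefficient of the difference is tested at the sorted rearrangement of `v`.
    refine sub_eq_zero.1 (tensor_ext Z fun v => ?_)
    rw [map_zero]
    obtain ⟨σ, hσ, hs⟩ := exists_blockSorted hb v
    rw [← coeff_comp_eq_zero_iff hZ hyz hσ]
    by_cases hr : RepeatsIn 1 p b (v ∘ σ)
    · rw [map_sub, map_sum, Finset.sum_eq_single (v ∘ σ)]
      · rw [map_smul, coeff_divPow_self hZ hr, smul_eq_mul, mul_one, sub_self]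
      · intro w hw hne
        have hw := (Finset.mem_filter.1 hw).2
        rw [map_smul]
        by_cases h0 : coeff Z (v ∘ σ) (divPow Z b w) = 0
        · rw [h0, smul_zero]
        · obtain ⟨τ, hτ, e⟩ := exists_of_coeff_divPow_ne_zero hZ h0
          rw [e] at hs
          exact absurd ((hw.1.comp_eq hτ hs).symm.trans e.symm) hne
      · intro h
        exact absurd (Finset.mem_filter.2 ⟨Finset.mem_univ _, hs, hr⟩) h
    · exact coeff_eq_zero_of_repeat hk hZ hyz hr
  rw [key]
  refine Submodule.sum_mem _ fun w hw => ?_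
  by_cases h0 : coeff Z w y = 0
  · rw [h0, zero_smul]; exact Submodule.zero_mem _
  · have hw := (Finset.mem_filter.1 hw).2
    exact Submodule.smul_mem _ _ (Submodule.subset_span ⟨w, hw.1, hw.2, hQ w h0, rfl⟩)

end Spanning

/-! ### Straightening -/

section Weight

variable {d N : ℕ} {δ : Type}

/-- The weight `∑ row(r) w_r` of a word. -/
def weight (row : Fin d → ℕ) (w : Fin d → Fin N) : ℕ := ∑ r, row r * (w r : ℕ)

theorem weight_comp {row : Fin d → ℕ} (w : Fin d → Fin N) {σ : Equiv.Perm (Fin d)}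
    (hσ : σ ∈ youngSubgroup row) : weight row (w ∘ σ) = weight row w := by
  rw [weight, weight, ← Equiv.sum_comp σ fun r => row r * (w r : ℕ)]
  exact Finset.sum_congr rfl fun r _ => by rw [hσ r]; rfl

variable {row : Fin d → ℕ} {D : Fin d → δ} {w : Fin d → Fin N} {x : Fin N}

/-- The change of weight is `∑ (row r - row (σ r)) (w (σ r) - x)`, and the hypothesis makes each
summand nonnegative. A tie makes every summand vanish, so a letter that changes rows equals `x`. -/
theorem weight_le_weight_comp
    (h : ∀ r s, D r = D s → row r < row s → x ≤ w r ∧ w s ≤ x) {σ : Equiv.Perm (Fin d)}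
    (hσ : σ ∈ youngSubgroup D) :
    weight row w ≤ weight row (w ∘ σ) ∧
      (weight row (w ∘ σ) = weight row w → ∀ r, row (σ r) ≠ row r → w (σ r) = x) := by
  have e1 : ((weight row (w ∘ σ) : ℕ) : ℤ) - (weight row w : ℕ) =
      ∑ r, ((row r : ℤ) - row (σ r)) * ((w (σ r) : ℕ) - (x : ℕ) : ℤ) := by
    have h1 : ((weight row w : ℕ) : ℤ) = ∑ r, (row (σ r) : ℤ) * (w (σ r) : ℕ) := by
      rw [weight, ← Equiv.sum_comp σ]; push_cast; rfl
    -- The pivot `x` may be subtracted freely because `σ` only permutes the row indices.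
    have h2 : ∑ r, ((row r : ℤ) - row (σ r)) * ((x : ℕ) : ℤ) = 0 := by
      rw [← Finset.sum_mul, Finset.sum_sub_distrib, Equiv.sum_comp σ fun r => (row r : ℤ)]
      simp
    rw [h1, weight]
    push_cast
    rw [← Finset.sum_sub_distrib, ← sub_zero (Finset.sum _ _), ← h2, ← Finset.sum_sub_distrib]
    exact Finset.sum_congr rfl fun r _ => by simp only [Function.comp_apply]; ring
  have e2 : ∀ r ∈ Finset.univ,
      0 ≤ ((row r : ℤ) - row (σ r)) * ((w (σ r) : ℕ) - (x : ℕ) : ℤ) := by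
    intro r _
    rcases lt_trichotomy (row r) (row (σ r)) with h1 | h1 | h1
    · have := (h r (σ r) (hσ r).symm h1).2
      rw [Fin.le_def] at this
      exact mul_nonneg_of_nonpos_of_nonpos (by omega) (by omega)
    · rw [h1, sub_self, zero_mul]
    · have := (h (σ r) r (hσ r) h1).1
      rw [Fin.le_def] at this
      exact mul_nonneg (by omega) (by omega)
  constructor
  · have := Finset.sum_nonneg e2
    omega
  · intro he r hr
    rw [he, sub_self] at e1
    have h1 := (Finset.sum_eq_zero_iff_of_nonneg e2).1 e1.symm r (Finset.mem_univ r)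
    rcases mul_eq_zero.1 h1 with h2 | h2
    · omega
    · exact Fin.ext (by omega)

/-- If a permutation moves between the rows only places with one and the same letter, its effect
on the word is that of a permutation within the rows. -/
theorem exists_row_preserving (hD : ∃ m, ∀ r s, D r = D s → row r ≠ row s → D r = m)
    {σ : Equiv.Perm (Fin d)} (hσ : σ ∈ youngSubgroup D)
    (hx : ∀ r, row (σ r) ≠ row r → w (σ r) = x) :
    ∃ τ ∈ youngSubgroup (fun r => (row r, D r)), w ∘ σ = w ∘ τ := by
  obtain ⟨m, hm⟩ := hD
  induction hn : (Finset.univ.filter fun r => row (σ r) ≠ row r).card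
    using Nat.strong_induction_on generalizing σ with
  | _ n ih =>
    by_cases hall : ∀ r, row (σ r) = row r
    · exact ⟨σ, fun r => Prod.ext (hall r) (hσ r), rfl⟩
    push Not at hall
    obtain ⟨r, hr⟩ := hall
    -- Since `r` is sent out of its row, by counting some `s` of another row is sent into it.
    obtain ⟨s, hs, hs'⟩ : ∃ s, row (σ s) = row r ∧ row s ≠ row r := by
      by_contra! hno
      have h1 : (Finset.univ.filter fun s => row (σ s) = row r) ⊆
          Finset.univ.filter fun s => row s = row r := by
        intro s hs
        rw [Finset.mem_filter] at hs ⊢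
        exact ⟨hs.1, hno s hs.2⟩
      have h2 : (Finset.univ.filter fun s => row s = row r).card ≤
          (Finset.univ.filter fun s => row (σ s) = row r).card := by
        refine Finset.card_le_card_of_injOn σ.symm ?_ σ.symm.injective.injOn
        intro s hs
        simpa using hs
      have h3 := Finset.eq_of_subset_of_card_le h1 h2
      have h4 : r ∈ Finset.univ.filter fun s => row (σ s) = row r := by rw [h3]; simp
      exact hr (Finset.mem_filter.1 h4).2
    have hbr : D (σ r) = m := hm _ r (hσ r) hr
    have hbs : D (σ s) = m := hm _ s (hσ s) (by rw [hs]; exact hs'.symm)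
    have hwr : w (σ r) = x := hx r hr
    have hws : w (σ s) = x := hx s (by rw [hs]; exact hs'.symm)
    have hrs : r ≠ s := fun e => hs' (by rw [e])
    -- Both targets carry the letter `x` and lie in the block `m`. Exchanging them leaves the word
    -- unchanged and keeps `r` in its row, so fewer places change rows.
    let σ' := Equiv.swap (σ r) (σ s) * σ
    have e1 : σ' r = σ s := by simp [σ']
    have e2 : σ' s = σ r := by simp [σ']
    have e3 : ∀ q, q ≠ r → q ≠ s → σ' q = σ q := by
      intro q h1 h2
      simp only [σ', Equiv.Perm.mul_apply]
      exact Equiv.swap_apply_of_ne_of_ne (fun h => h1 (σ.injective h))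
        fun h => h2 (σ.injective h)
    have hw' : w ∘ σ' = w ∘ σ := by
      funext q
      by_cases h1 : q = r
      · simp only [Function.comp_apply, h1, e1, hws, hwr]
      · by_cases h2 : q = s
        · simp only [Function.comp_apply, h2, e2, hws, hwr]
        · simp only [Function.comp_apply, e3 q h1 h2]
    have hσ' : σ' ∈ youngSubgroup D :=
      (youngSubgroup D).mul_mem (swap_mem_youngSubgroup (hbr.trans hbs.symm)) hσ
    have hx' : ∀ q, row (σ' q) ≠ row q → w (σ' q) = x := by
      intro q hq
      by_cases h1 : q = r
      · rw [h1, e1, hws]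
      · by_cases h2 : q = s
        · rw [h2, e2, hwr]
        · rw [e3 q h1 h2] at hq ⊢
          exact hx q hq
    have hcard : (Finset.univ.filter fun q => row (σ' q) ≠ row q).card < n := by
      rw [← hn]
      refine Finset.card_lt_card (Finset.ssubset_iff_of_subset ?_ |>.2 ⟨r, by simpa using hr, ?_⟩)
      · intro q hq
        rw [Finset.mem_filter] at hq ⊢
        refine ⟨hq.1, ?_⟩
        by_cases h1 : q = r
        · rw [h1]; exact hr
        · by_cases h2 : q = s
          · rw [h2, hs]; exact hs'.symm
          · rw [← e3 q h1 h2]; exact hq.2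
      · simp [e1, hs]
    obtain ⟨τ, hτ, e⟩ := ih _ hcard hσ' hx' rfl
    exact ⟨τ, hτ, hw'.symm.trans e⟩

end Weight

/-! ### The leading term of a relation -/

section Straightening

variable {k : Type u} [Field k] {d N : ℕ} {δ : Type} {M : SVec k} {Z : Module.Basis (Fin N) k M}
  {p : Fin N → ZMod 2} {row : Fin d → ℕ} {D : Fin d → δ} {w : Fin d → Fin N} {x : Fin N}

theorem gammaPiSpace_mono {β γ : Type} {b : Fin d → β} {f : Fin d → γ}
    (h : youngSubgroup f ≤ youngSubgroup b) : gammaPiSpace M b ≤ gammaPiSpace M f :=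
  fun _ hx σ hσ => hx σ (h hσ)

/-- If a row permutation carries `w` into the support of `divPow Z D w`, the weights tie, so its
effect on `w` is that of a permutation preserving both rows and blocks. Equal letters of a row share
a block by `hst`, so the permutation itself preserves `D`: only the trivial coset counts and no
multiplicities arise. -/
theorem coeff_cosetSum_divPow (hZ : ∀ i, Z i ∈ M.part (p i))
    (hx : ∀ r s, D r = D s → row r < row s → x ≤ w r ∧ w s ≤ x)
    (hD : ∃ m, ∀ r s, D r = D s → row r ≠ row s → D r = m)
    (hst : ∀ r s, row r = row s → w r = w s → D r = D s) (hrep : RepeatsIn 1 p D w) :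
    coeff Z w (cosetSum M (fun r => (row r, D r)) row (divPow Z D w)) = 1 := by
  rw [coeff_cosetSum hZ _ row (gammaPiSpace_mono (fun σ hσ r => congrArg Prod.snd (hσ r))
    (divPow_mem hZ hrep)), coeff_divPow_self hZ hrep]
  intro g hg h0
  obtain ⟨σ, hσ, e⟩ := exists_of_coeff_divPow_ne_zero hZ h0
  have hwt : weight row (w ∘ σ) = weight row w := by rw [← e, weight_comp w hg]
  obtain ⟨τ, hτ, e'⟩ := exists_row_preserving hD hσ ((weight_le_weight_comp hx hσ).2 hwt)
  intro r
  refine Prod.ext (hg r) ?_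
  have h1 : D (τ r) = D r := congrArg Prod.snd (hτ r)
  refine Eq.trans ?_ h1
  refine hst _ _ ?_ (congrFun (e.trans e') r)
  rw [hg r]
  exact (congrArg Prod.fst (hτ r)).symm

theorem weight_lt_of_coeff_cosetSum_ne_zero (hZ : ∀ i, Z i ∈ M.part (p i))
    (hx : ∀ r s, D r = D s → row r < row s → x ≤ w r ∧ w s ≤ x)
    (hD : ∃ m, ∀ r s, D r = D s → row r ≠ row s → D r = m) {v : Fin d → Fin N}
    (h : coeff Z v (cosetSum M (fun r => (row r, D r)) row (divPow Z D w)) ≠ 0) :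
    weight row w < weight row v ∨ ∃ σ ∈ youngSubgroup row, v = w ∘ σ := by
  obtain ⟨g, hg, h0⟩ := exists_coeff_ne_zero_of_cosetSum hZ _ row h
  obtain ⟨σ, hσ, e⟩ := exists_of_coeff_divPow_ne_zero hZ h0
  have hle := weight_le_weight_comp hx hσ
  have hv : weight row v = weight row (w ∘ σ) := by rw [← e, weight_comp v hg]
  rcases hle.1.lt_or_eq with hlt | heq
  · left; rwa [hv]
  · right
    obtain ⟨τ, hτ, e'⟩ := exists_row_preserving hD hσ (hle.2 heq.symm)
    refine ⟨τ * g⁻¹, (youngSubgroup row).mul_mem (fun r => congrArg Prod.fst (hτ r))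
      ((youngSubgroup row).inv_mem hg), ?_⟩
    have h1 := e.trans e'
    funext r
    have h2 := congrFun h1 (g⁻¹ r)
    simpa using h2

/-- Modulo the relation, a sorted product of divided powers is a combination of others of larger
weight. -/
theorem divPow_sub_mem_span (hk : ringChar k ≠ 2) (hZ : ∀ i, Z i ∈ M.part (p i))
    (hrow : Monotone row) (hw : RepeatsIn 1 p row w)
    (hx : ∀ r s, D r = D s → row r < row s → x ≤ w r ∧ w s ≤ x)
    (hD : ∃ m, ∀ r s, D r = D s → row r ≠ row s → D r = m)
    (hst : ∀ r s, row r = row s → w r = w s → D r = D s) (hrep : RepeatsIn 1 p D w) :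
    divPow Z row w - cosetSum M (fun r => (row r, D r)) row (divPow Z D w) ∈
      Submodule.span k {y | ∃ v, BlockSorted row v ∧ RepeatsIn 1 p row v ∧
        weight row w < weight row v ∧ y = divPow Z row v} := by
  have hmem : divPow Z row w - cosetSum M (fun r => (row r, D r)) row (divPow Z D w) ∈
      gammaPiSpace M row :=
    Submodule.sub_mem _ (divPow_mem hZ hw) (cosetSum_mem M _ row
      (gammaPiSpace_mono (fun σ hσ r => congrArg Prod.snd (hσ r)) (divPow_mem hZ hrep)))
  refine mem_span_divPow hk hZ hrow hmem fun v hv => ?_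
  -- The two leading coefficients cancel at `w`, hence on its whole row orbit; every other word of
  -- the relation has larger weight.
  have h0 : coeff Z w
      (divPow Z row w - cosetSum M (fun r => (row r, D r)) row (divPow Z D w)) = 0 := by
    rw [map_sub, coeff_divPow_self hZ hw, coeff_cosetSum_divPow hZ hx hD hst hrep, sub_self]
  have horb : ¬ ∃ σ ∈ youngSubgroup row, v = w ∘ σ := by
    rintro ⟨σ, hσ, rfl⟩
    exact hv ((coeff_comp_eq_zero_iff hZ hmem hσ w).2 h0)
  by_cases h1 : coeff Z v (divPow Z row w) = 0
  · refine (weight_lt_of_coeff_cosetSum_ne_zero hZ hx hD fun h2 => hv ?_).resolve_right horb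
    rw [map_sub, h1, h2, sub_self]
  · exact absurd (exists_of_coeff_divPow_ne_zero hZ h1) horb

end Straightening

/-! ### Straightening of tableaux -/

section Tableaux

variable {lam mu : YoungDiagram} {N : ℕ} {p : Fin N → ZMod 2}

theorem rowRead_symm_lt {s : Finset (ℕ × ℕ)} {a b : s} (h : a.1.1 = b.1.1) (h' : a.1.2 < b.1.2) :
    (rowRead s).symm a < (rowRead s).symm b := by
  by_contra! hle
  rcases hle.lt_or_eq with hlt | heq
  · have := rowRead_lt s hlt
    simp only [Equiv.apply_symm_apply] at this
    omega
  · have := (rowRead s).symm.injective heq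
    rw [this] at h'
    exact lt_irrefl _ h'

theorem rowBlock_monotone : Monotone (rowBlock lam mu) := by
  intro r s h
  rcases h.lt_or_eq with h | h
  · rcases rowRead_lt _ h with h1 | h1
    · exact h1.le
    · exact h1.1.le
  · rw [h]

/-- The tableau with a given reading word. -/
def ofWord (w : Fin (skewSize lam mu) → Fin N) : Tableau lam mu N :=
  w ∘ (rowRead (skewCells lam mu)).symm

theorem word_ofWord (w : Fin (skewSize lam mu) → Fin N) : word (ofWord w) = w := by
  funext r
  simp [word, ofWord]

theorem word_symm (t : Tableau lam mu N) (a : skewCells lam mu) :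
    word t ((rowRead (skewCells lam mu)).symm a) = t a := by
  simp [word]

theorem rowCostandard_iff {t : Tableau lam mu N} :
    RowCostandard p t ↔ BlockSorted (rowBlock lam mu) (word t) ∧
      RepeatsIn 1 p (rowBlock lam mu) (word t) := by
  constructor
  · intro ht
    constructor
    · intro r s h
      rcases h.lt_or_eq with h | h
      · rw [Prod.Lex.le_iff]
        rcases rowRead_lt _ h with h1 | h1
        · exact Or.inl h1
        · exact Or.inr ⟨h1.1, (ht _ _ h1.1 h1.2).1⟩
      · rw [h]
    · intro r s hrs hb hw
      rcases lt_or_gt_of_ne hrs with h | h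
      · rcases rowRead_lt _ h with h1 | h1
        · exact absurd hb h1.ne
        · exact (ht _ _ h1.1 h1.2).2 hw
      · rcases rowRead_lt _ h with h1 | h1
        · exact absurd hb h1.ne'
        · rw [hw]; exact (ht _ _ h1.1 h1.2).2 hw.symm
  · rintro ⟨hs, hr⟩ a b h h'
    have hlt := rowRead_symm_lt h h'
    have h1 := hs hlt.le
    rw [Prod.Lex.le_iff] at h1
    have hb : rowBlock lam mu ((rowRead (skewCells lam mu)).symm a) =
        rowBlock lam mu ((rowRead (skewCells lam mu)).symm b) := by simpa [rowBlock] using h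
    have h2 := hr _ _ hlt.ne hb
    rw [word_symm, word_symm] at h2
    refine ⟨?_, h2⟩
    rcases h1 with h1 | h1
    · exact absurd hb (by simpa using h1.ne)
    · simpa [word_symm] using h1.2

/-- Columns of a skew diagram have no gaps, and equality of two entries forces equality of all
entries between them. -/
theorem colCostandard_of_adjacent {t : Tableau lam mu N}
    (h : ∀ (i c : ℕ) (h1 : (i, c) ∈ skewCells lam mu) (h2 : (i + 1, c) ∈ skewCells lam mu),
      t ⟨_, h1⟩ ≤ t ⟨_, h2⟩ ∧ (t ⟨_, h1⟩ = t ⟨_, h2⟩ → p (t ⟨_, h1⟩) = 0)) :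
    ColCostandard p t := by
  rintro ⟨⟨i, c⟩, ha⟩ ⟨⟨j, c'⟩, hb⟩ hc hij
  simp only at hc hij
  subst hc
  induction j, hij using Nat.le_induction with
  | base => exact h i c ha hb
  | succ j hj ih =>
    have hm : (j, c) ∈ skewCells lam mu := by
      have h1 := mem_skewCells.1 ha
      have h2 := mem_skewCells.1 hb
      have h3 := mu.rowLen_anti i j (by omega)
      have h4 := lam.rowLen_anti j (j + 1) (by omega)
      rw [mem_skewCells]; omega
    have h1 := ih hm
    have h2 := h j c hm hb
    refine ⟨h1.1.trans h2.1, fun e => h1.2 (le_antisymm h1.1 ?_)⟩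
    rw [e]; exact h2.1

/-- At a descent of a column of a row costandard tableau, there is a relation `◇_i(λ/μ, u, v)`
whose middle block consists of entries `≥ x` in the row `i` and `≤ x` in the row `i + 1`. -/
theorem exists_straightening {w : Fin (skewSize lam mu) → Fin N}
    (hs : RowCostandard p (ofWord w)) (hc : ¬ ColCostandard p (ofWord w)) :
    ∃ (i u v : ℕ) (x : Fin N), u + v + mu.rowLen i < lam.rowLen (i + 1) ∧
      (∀ r s, diamondBlock lam mu i u v r = diamondBlock lam mu i u v s →
        rowBlock lam mu r < rowBlock lam mu s → x ≤ w r ∧ w s ≤ x) ∧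
      (∃ m, ∀ r s, diamondBlock lam mu i u v r = diamondBlock lam mu i u v s →
        rowBlock lam mu r ≠ rowBlock lam mu s → diamondBlock lam mu i u v r = m) ∧
      (∀ r s, rowBlock lam mu r = rowBlock lam mu s → w r = w s →
        diamondBlock lam mu i u v r = diamondBlock lam mu i u v s) ∧
      RepeatsIn 1 p (diamondBlock lam mu i u v) w := by
  classical
  have hrep := (rowCostandard_iff.1 hs).2
  rw [word_ofWord] at hrep
  obtain ⟨i, c, h1, h2, hviol⟩ : ∃ (i c : ℕ) (h1 : (i, c) ∈ skewCells lam mu)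
      (h2 : (i + 1, c) ∈ skewCells lam mu), ¬ (ofWord w ⟨_, h1⟩ ≤ ofWord w ⟨_, h2⟩ ∧
        (ofWord w ⟨_, h1⟩ = ofWord w ⟨_, h2⟩ → p (ofWord w ⟨_, h1⟩) = 0)) := by
    by_contra! h
    exact hc (colCostandard_of_adjacent fun i c h1 h2 => h i c h1 h2)
  set t := ofWord w with ht
  set x := t ⟨_, h1⟩ with hx
  set y := t ⟨_, h2⟩ with hy
  have hwt : ∀ r, w r = t (rowRead (skewCells lam mu) r) := by
    intro r; simp [ht, ofWord]
  have hyx : y ≤ x := by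
    by_contra! hlt
    exact hviol ⟨hlt.le, fun e => absurd e hlt.ne⟩
  -- A violation is either a strict descent or a repeated odd letter.
  have hodd : x = y → p x = 1 := by
    intro e
    rcases zmod2_cases (p x) with h | h
    · exact absurd ⟨e.le, fun _ => h⟩ hviol
    · exact h
  have m1 := mem_skewCells.1 h1
  have m2 := mem_skewCells.1 h2
  have hle : ∀ (j c c' : ℕ) (h : (j, c) ∈ skewCells lam mu) (h' : (j, c') ∈ skewCells lam mu),
      c ≤ c' → t ⟨_, h⟩ ≤ t ⟨_, h'⟩ := by
    intro j c c' h h' hcc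
    rcases hcc.lt_or_eq with hlt | rfl
    · exact (hs ⟨_, h⟩ ⟨_, h'⟩ rfl hlt).1
    · exact le_rfl
  -- The least such `u` counts the entries `< x` of row `i`; likewise the least `v` below counts the
  -- entries `> y` of row `i + 1`. The column `c` of the violation witnesses existence.
  have hexu : ∃ u, ∃ h : (i, mu.rowLen i + u) ∈ skewCells lam mu, x ≤ t ⟨_, h⟩ := by
    have e : mu.rowLen i + (c - mu.rowLen i) = c := by omega
    refine ⟨c - mu.rowLen i, by rwa [e], ?_⟩
    exact hle _ _ _ _ _ e.ge
  have hexv : ∃ v, ∃ h : (i + 1, lam.rowLen (i + 1) - 1 - v) ∈ skewCells lam mu,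
      t ⟨_, h⟩ ≤ y := by
    have e : lam.rowLen (i + 1) - 1 - (lam.rowLen (i + 1) - 1 - c) = c := by omega
    refine ⟨lam.rowLen (i + 1) - 1 - c, by rwa [e], ?_⟩
    exact hle _ _ _ _ _ e.le
  -- This bound and the next add up to `λ_{i+1} - 1 - μ_i`: column `c` itself remains, which gives
  -- the strict inequality required of `u + v`.
  have hu : Nat.find hexu ≤ c - mu.rowLen i := by
    have e : mu.rowLen i + (c - mu.rowLen i) = c := by omega
    exact Nat.find_min' hexu ⟨by rwa [e], hle _ _ _ _ _ e.ge⟩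
  have hv : Nat.find hexv ≤ lam.rowLen (i + 1) - 1 - c := by
    have e : lam.rowLen (i + 1) - 1 - (lam.rowLen (i + 1) - 1 - c) = c := by omega
    exact Nat.find_min' hexv ⟨by rwa [e], hle _ _ _ _ _ e.le⟩
  obtain ⟨hu1, hu2⟩ := Nat.find_spec hexu
  obtain ⟨hv1, hv2⟩ := Nat.find_spec hexv
  have hu3 := fun n => Nat.find_min (H := hexu) (m := n)
  have hv3 := fun n => Nat.find_min (H := hexv) (m := n)
  generalize Nat.find hexu = u at *
  generalize Nat.find hexv = v at *
  clear hexu hexv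
  have f1 : ∀ c' (h : (i, c') ∈ skewCells lam mu), c' < mu.rowLen i + u → t ⟨_, h⟩ < x := by
    intro c' h hlt
    have hm := (mem_skewCells.1 h).1
    have e : mu.rowLen i + (c' - mu.rowLen i) = c' := by omega
    by_contra! hge
    exact hu3 (c' - mu.rowLen i) (by omega) ⟨by rwa [e], hge.trans (hle _ _ _ _ _ e.ge)⟩
  have f2 : ∀ c' (h : (i, c') ∈ skewCells lam mu), ¬ c' < mu.rowLen i + u → x ≤ t ⟨_, h⟩ :=
    fun c' h hge => hu2.trans (hle _ _ _ _ _ (by omega))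
  have f3 : ∀ c' (h : (i + 1, c') ∈ skewCells lam mu), lam.rowLen (i + 1) ≤ c' + v →
      y < t ⟨_, h⟩ := by
    intro c' h hlt
    have hm := (mem_skewCells.1 h).2
    have e : lam.rowLen (i + 1) - 1 - (lam.rowLen (i + 1) - 1 - c') = c' := by omega
    by_contra! hge
    exact hv3 (lam.rowLen (i + 1) - 1 - c') (by omega)
      ⟨by rwa [e], (hle _ _ _ _ _ e.le).trans hge⟩
  have f4 : ∀ c' (h : (i + 1, c') ∈ skewCells lam mu), ¬ lam.rowLen (i + 1) ≤ c' + v →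
      t ⟨_, h⟩ ≤ y :=
    fun c' h hge => (hle _ _ _ _ _ (by omega)).trans hv2
  -- Only the middle block meets two rows, and there the upper entries are `≥ x` and the lower ones
  -- `≤ y`.
  have hrows : ∀ r s, diamondBlock lam mu i u v r = diamondBlock lam mu i u v s →
      rowBlock lam mu r < rowBlock lam mu s →
      diamondBlock lam mu i u v r = (i, 1) ∧ x ≤ w r ∧ w s ≤ y := by
    intro r s e hlt
    rw [hwt r, hwt s]
    simp only [diamondBlock, rowBlock] at e hlt ⊢
    generalize rowRead (skewCells lam mu) r = a at *
    generalize rowRead (skewCells lam mu) s = b at *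
    obtain ⟨⟨j, a⟩, ha⟩ := a
    obtain ⟨⟨l, b⟩, hb⟩ := b
    simp only at e hlt ⊢
    by_cases hj : j = i
    · subst hj
      have hl : l ≠ j := by omega
      rw [if_pos rfl, if_neg hl] at e
      by_cases hl1 : l = j + 1
      · subst hl1
        rw [if_pos rfl] at e
        split_ifs at e with q1 q2 q2
        · simp at e
        · simp at e
        · simp at e
        · rw [if_pos rfl, if_neg q1]
          exact ⟨rfl, f2 _ _ q1, f4 _ _ q2⟩
      · rw [if_neg hl1] at e
        split_ifs at e
        · simp only [Prod.mk.injEq] at e; omega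
        · simp at e
    · exfalso
      split_ifs at e <;> simp only [Prod.mk.injEq] at e <;> omega
  refine ⟨i, u, v, x, by omega, fun r s e h => ?_, ⟨(i, 1), fun r s e h => ?_⟩, ?_, ?_⟩
  · have := (hrows r s e h).2
    exact ⟨this.1, this.2.trans hyx⟩
  · rcases lt_or_gt_of_ne h with h | h
    · exact (hrows r s e h).1
    · rw [e]; exact (hrows s r e.symm h).1
  · intro r s e h
    rw [hwt r, hwt s] at h
    simp only [diamondBlock, rowBlock] at e h ⊢
    generalize rowRead (skewCells lam mu) r = a at *
    generalize rowRead (skewCells lam mu) s = b at *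
    obtain ⟨⟨j, a⟩, ha⟩ := a
    obtain ⟨⟨l, b⟩, hb⟩ := b
    simp only at e h ⊢
    subst e
    by_cases hj : j = i
    · subst hj
      rw [if_pos rfl, if_pos rfl]
      split_ifs with q1 q2 q2
      · rfl
      · exact absurd h ((f1 _ _ q1).trans_le (f2 _ _ q2)).ne
      · exact absurd h ((f1 _ _ q2).trans_le (f2 _ _ q1)).ne'
      · rfl
    · rw [if_neg hj, if_neg hj]
      by_cases hj1 : j = i + 1
      · subst hj1
        rw [if_pos rfl, if_pos rfl]
        split_ifs with q1 q2 q2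
        · rfl
        · exact absurd h ((f4 _ _ q2).trans_lt (f3 _ _ q1)).ne'
        · exact absurd h ((f4 _ _ q1).trans_lt (f3 _ _ q2)).ne
        · rfl
      · rw [if_neg hj1, if_neg hj1]
  -- A letter common to both rows of the middle block is squeezed between `x` and `y ≤ x`, so it
  -- equals both and is odd.
  · intro r s hrs e h
    by_cases hb : rowBlock lam mu r = rowBlock lam mu s
    · exact hrep r s hrs hb h
    · rcases lt_or_gt_of_ne hb with hlt | hlt
      · have h3 := (hrows r s e hlt).2
        have e1 : x = y := le_antisymm (h3.1.trans (h.le.trans h3.2)) hyx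
        have e2 : w r = x := le_antisymm (h.le.trans (h3.2.trans hyx)) h3.1
        rw [e2]; exact hodd e1
      · have h3 := (hrows s r e.symm hlt).2
        have e1 : x = y := le_antisymm (h3.1.trans (h.ge.trans h3.2)) hyx
        have e2 : w r = x := le_antisymm (h3.2.trans hyx) (h3.1.trans h.ge)
        rw [e2]; exact hodd e1

theorem weight_rowBlock_le (w : Fin (skewSize lam mu) → Fin N) :
    weight (rowBlock lam mu) w ≤ ∑ r, rowBlock lam mu r * N :=
  Finset.sum_le_sum fun r _ => Nat.mul_le_mul_left _ (w r).2.le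

variable {k : Type u} [Field k] {M : SVec k} {Z : Module.Basis (Fin N) k M}

theorem zPi_val (hZ : ∀ i, Z i ∈ M.part (p i)) (t : Tableau lam mu N) (ht : RowCostandard p t) :
    (zPi Z hZ t ht).1 = divPow Z (rowBlock lam mu) (word t) := by
  rw [divPow, wordBasis_apply]
  rfl

/-- The costandard elements together with `Im ◇` span `Γ_Π^{λ/μ} M`. -/
theorem span_costandard_sup_imDiamond (hk : ringChar k ≠ 2) (hZ : ∀ i, Z i ∈ M.part (p i)) :
    Submodule.span k (Set.range fun t : CostandardTableau lam mu p => zPi Z hZ t.1 t.2.1) ⊔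
      (imDiamond lam mu k).sub M = ⊤ := by
  set Q : Submodule k ((gammaShape lam mu k).obj M) :=
    Submodule.span k (Set.range fun t : CostandardTableau lam mu p => zPi Z hZ t.1 t.2.1) ⊔
      (imDiamond lam mu k).sub M with hQ
  let Q' : Submodule k (tpow M (skewSize lam mu)) :=
    Q.map (gammaPiSpace M (rowBlock lam mu)).subtype
  -- Downward induction on the weight, measured by its distance `n` from an upper bound.
  have key : ∀ (n : ℕ) (w : Fin (skewSize lam mu) → Fin N), BlockSorted (rowBlock lam mu) w →
      RepeatsIn 1 p (rowBlock lam mu) w →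
      (∑ r, rowBlock lam mu r * N) - weight (rowBlock lam mu) w = n →
      divPow Z (rowBlock lam mu) w ∈ Q' := by
    intro n
    induction n using Nat.strong_induction_on with
    | _ n ih =>
      intro w hw hrep hn
      have ht : RowCostandard p (ofWord w) := by
        rw [rowCostandard_iff, word_ofWord]; exact ⟨hw, hrep⟩
      by_cases hcol : ColCostandard p (ofWord w)
      · refine ⟨zPi Z hZ (ofWord w) ht, Submodule.mem_sup_left
          (Submodule.subset_span ⟨⟨ofWord w, ht, hcol⟩, rfl⟩), ?_⟩
        rw [Submodule.subtype_apply, zPi_val, word_ofWord]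
      · obtain ⟨i, u, v, x, huv, hx, hD, hst, hrepD⟩ := exists_straightening ht hcol
        have h1 := divPow_sub_mem_span hk hZ rowBlock_monotone hrep hx hD hst hrepD
        have h2 : Submodule.span k {y | ∃ v, BlockSorted (rowBlock lam mu) v ∧
            RepeatsIn 1 p (rowBlock lam mu) v ∧
            weight (rowBlock lam mu) w < weight (rowBlock lam mu) v ∧
            y = divPow Z (rowBlock lam mu) v} ≤ Q' := by
          refine Submodule.span_le.2 ?_
          rintro _ ⟨w', hw', hrep', hlt, rfl⟩
          have := weight_rowBlock_le w'
          exact ih _ (by omega) w' hw' hrep' rfl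
        have h3 : cosetSum M (fun r => (rowBlock lam mu r, diamondBlock lam mu i u v r))
            (rowBlock lam mu) (divPow Z (diamondBlock lam mu i u v) w) ∈ Q' := by
          refine ⟨(diamond lam mu k i u v).app M ⟨_, divPow_mem hZ hrepD⟩,
            Submodule.mem_sup_right ?_, rfl⟩
          exact Submodule.mem_iSup_of_mem ⟨(i, u, v), huv⟩ ⟨_, rfl⟩
        have h4 := Submodule.add_mem _ (h2 h1) h3
        rwa [sub_add_cancel] at h4
  rw [eq_top_iff]
  intro y _
  have h1 := mem_span_divPow hk hZ rowBlock_monotone y.2 (Q := fun _ => True) fun _ _ => trivial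
  have h2 : y.1 ∈ Q' := by
    refine Submodule.span_le.2 ?_ h1
    rintro _ ⟨w, hw, hrep, _, rfl⟩
    exact key _ w hw hrep rfl
  obtain ⟨z, hz, e⟩ := h2
  rwa [← Subtype.ext (a1 := z) (a2 := y) e]

end Tableaux

/-! ### Linear independence of the costandard elements -/

section Functionals

variable {k : Type u} [Field k] {d N : ℕ} {β : Type} {M : SVec k} {Z : Module.Basis (Fin N) k M}
  {p : Fin N → ZMod 2}

/-- In a vanishing combination, the functional of an index of maximal weight among those with
nonzero coefficient sees only its own vector. -/
theorem linearIndependent_of_triangular {ι V : Type*} [AddCommGroup V] [Module k V] {e : ι → V}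
    (φ : ι → V →ₗ[k] k) (wt : ι → ℕ) (h1 : ∀ i, φ i (e i) ≠ 0)
    (h2 : ∀ i j, i ≠ j → φ i (e j) ≠ 0 → wt i < wt j) : LinearIndependent k e := by
  classical
  rw [linearIndependent_iff']
  intro s g hg
  by_contra! hne
  obtain ⟨j, hj, hgj⟩ := hne
  obtain ⟨i, hi, hmax⟩ := (s.filter fun i => g i ≠ 0).exists_max_image wt
    ⟨j, Finset.mem_filter.2 ⟨hj, hgj⟩⟩
  rw [Finset.mem_filter] at hi
  have h := congrArg (φ i) hg
  rw [map_sum, map_zero, Finset.sum_eq_single i, map_smul, smul_eq_mul] at h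
  · exact (mul_ne_zero hi.2 (h1 i)) h
  · intro l hl hli
    rw [map_smul]
    by_cases hgl : g l = 0
    · rw [hgl, zero_smul]
    · by_cases h0 : φ i (e l) = 0
      · rw [h0, smul_zero]
      · have h3 := h2 i l hli.symm h0
        have h4 := hmax l (Finset.mem_filter.2 ⟨hl, hgl⟩)
        omega
  · intro h; exact absurd hi.1 h

open Classical in
/-- The sign with which `Z_w` becomes `Z_v` in the coinvariants of the Young subgroup of `b`, and
`0` if `w` does not lie in the orbit of `v`. -/
def orbitSign (p : Fin N → ZMod 2) (b : Fin d → β) (v w : Fin d → Fin N) : ℤ :=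
  if h : ∃ τ ∈ youngSubgroup b, w ∘ τ = v then koszulSign (p ∘ w) h.choose else 0

/-- Two permutations carrying `w` to `v` differ by a stabilizer of `v`, whose sign is 1 as repeated
letters are even; so the choice is immaterial. -/
theorem orbitSign_eq {b : Fin d → β} {v w : Fin d → Fin N} (hv : RepeatsIn 0 p b v)
    {τ : Equiv.Perm (Fin d)} (hτ : τ ∈ youngSubgroup b) (h : w ∘ τ = v) :
    orbitSign p b v w = koszulSign (p ∘ w) τ := by
  have hex : ∃ τ ∈ youngSubgroup b, w ∘ τ = v := ⟨τ, hτ, h⟩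
  rw [orbitSign, dif_pos hex]
  obtain ⟨h1, h2⟩ := hex.choose_spec
  generalize hex.choose = ρ at h1 h2 ⊢
  have e : koszulSign (p ∘ w) ρ =
      koszulSign (p ∘ w) τ * koszulSign (p ∘ v) (τ⁻¹ * ρ) := by
    conv_lhs => rw [← mul_inv_cancel_left τ ρ, koszulSign_mul]
    rw [← h]
    rfl
  rw [e, koszulSign_eq_one_of_repeatsIn hv, mul_one]
  refine mem_letterBlock ((youngSubgroup b).mul_mem ((youngSubgroup b).inv_mem hτ) h1) ?_
  conv_lhs => rw [← h]
  rw [← h2]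
  funext r
  simp

theorem exists_of_orbitSign_ne_zero {b : Fin d → β} {v w : Fin d → Fin N}
    (h : orbitSign p b v w ≠ 0) : ∃ τ ∈ youngSubgroup b, w ∘ τ = v := by
  by_contra hno
  exact h (dif_neg hno)

/-- The coefficient of `Z_v` in the coinvariants of the Young subgroup of `b`. -/
def orbitCoeff (Z : Module.Basis (Fin N) k M) (p : Fin N → ZMod 2) (b : Fin d → β)
    (v : Fin d → Fin N) : tpow M d →ₗ[k] k :=
  (wordBasis d Z).constr k fun w => (orbitSign p b v w : k)

theorem orbitCoeff_wordBasis (b : Fin d → β) (v w : Fin d → Fin N) :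
    orbitCoeff Z p b v (wordBasis d Z w) = (orbitSign p b v w : k) :=
  (wordBasis d Z).constr_basis k _ w

/-- Invariance lets the functional descend to the coinvariants, where `θ̂` takes its values. -/
theorem orbitCoeff_superAct (hZ : ∀ i, Z i ∈ M.part (p i)) {b : Fin d → β} {v : Fin d → Fin N}
    (hv : RepeatsIn 0 p b v) {σ : Equiv.Perm (Fin d)} (hσ : σ ∈ youngSubgroup b) (x : tpow M d) :
    orbitCoeff Z p b v (superAct M σ x) = orbitCoeff Z p b v x := by
  have h : orbitCoeff Z p b v ∘ₗ superAct M σ = orbitCoeff Z p b v := by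
    refine (wordBasis d Z).ext fun w => ?_
    rw [LinearMap.comp_apply, superAct_wordBasis hZ, map_smul, orbitCoeff_wordBasis,
      orbitCoeff_wordBasis, smul_eq_mul, ← Int.cast_mul]
    congr 1
    by_cases hex : ∃ τ ∈ youngSubgroup b, (w ∘ σ) ∘ τ = v
    · obtain ⟨τ, hτ, e⟩ := hex
      rw [orbitSign_eq hv hτ e, orbitSign_eq hv ((youngSubgroup b).mul_mem hσ hτ) e,
        koszulSign_mul, Units.val_mul]
      rfl
    · have h1 : orbitSign p b v (w ∘ σ) = 0 := by
        by_contra h; exact hex (exists_of_orbitSign_ne_zero h)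
      have h2 : orbitSign p b v w = 0 := by
        by_contra h
        obtain ⟨τ, hτ, e⟩ := exists_of_orbitSign_ne_zero h
        refine hex ⟨σ⁻¹ * τ, (youngSubgroup b).mul_mem ((youngSubgroup b).inv_mem hσ) hτ, ?_⟩
        rw [← e]; funext r; simp
      rw [h1, h2, mul_zero]
  exact LinearMap.congr_fun h x

theorem symKerSpace_le_ker_orbitCoeff (hZ : ∀ i, Z i ∈ M.part (p i)) {b : Fin d → β}
    {v : Fin d → Fin N} (hv : RepeatsIn 0 p b v) :
    symKerSpace M b ≤ LinearMap.ker (orbitCoeff Z p b v) := by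
  refine Submodule.span_le.2 ?_
  rintro _ ⟨σ, hσ, x, rfl⟩
  change orbitCoeff Z p b v _ = 0
  rw [map_sub, orbitCoeff_superAct hZ hv hσ, sub_self]

theorem orbitCoeff_superAct_eq_sum (hZ : ∀ i, Z i ∈ M.part (p i)) (b : Fin d → β)
    (v : Fin d → Fin N) (σ : Equiv.Perm (Fin d)) (x : tpow M d) :
    orbitCoeff Z p b v (superAct M σ x) =
      ∑ w, coeff Z w x * (((koszulSign (p ∘ w) σ : ℤ) : k) * (orbitSign p b v (w ∘ σ) : k)) := by
  conv_lhs => rw [← sum_coeff Z x]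
  rw [map_sum, map_sum]
  refine Finset.sum_congr rfl fun w _ => ?_
  rw [map_smul, map_smul, superAct_wordBasis hZ, map_smul, orbitCoeff_wordBasis, smul_eq_mul,
    smul_eq_mul]

end Functionals

/-! ### Column weights and triangularity -/

section Independence

variable {lam mu : YoungDiagram} {N : ℕ} {p : Fin N → ZMod 2}

theorem colRead_lt (s : Finset (ℕ × ℕ)) {r r' : Fin s.card} (h : r < r') :
    (colRead s r).1.2 < (colRead s r').1.2 ∨
      (colRead s r).1.2 = (colRead s r').1.2 ∧ (colRead s r).1.1 < (colRead s r').1.1 := by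
  have h1 := ((s.map ((Equiv.prodComm ℕ ℕ).trans toLex).toEmbedding).orderIsoOfFin
    (Finset.card_map _)).strictMono h
  have e : ∀ r, (((s.map ((Equiv.prodComm ℕ ℕ).trans toLex).toEmbedding).orderIsoOfFin
    (Finset.card_map _)) r).1 = toLex (colRead s r).1.swap := fun r => rfl
  have h2 : toLex (colRead s r).1.swap < toLex (colRead s r').1.swap := by
    rw [← e, ← e]; exact h1
  exact Prod.Lex.lt_iff.1 h2

theorem word_sigmaConj (t : Tableau lam mu N) (r : Fin (skewSize lam mu)) :
    word t (sigmaConj lam mu r) = t (colRead (skewCells lam mu) r) := by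
  simp [word, sigmaConj]

theorem ColCostandard.blockSorted {t : Tableau lam mu N} (ht : ColCostandard p t) :
    BlockSorted (colBlock lam mu) (word t ∘ sigmaConj lam mu) := by
  intro r s h
  rcases h.lt_or_eq with h | h
  · rw [Prod.Lex.le_iff]
    rcases colRead_lt _ h with h1 | h1
    · exact Or.inl h1
    · refine Or.inr ⟨h1.1, ?_⟩
      simp only [Function.comp_apply, word_sigmaConj]
      exact (ht _ _ h1.1 h1.2).1
  · rw [h]

theorem ColCostandard.repeatsIn {t : Tableau lam mu N} (ht : ColCostandard p t) :
    RepeatsIn 0 p (colBlock lam mu) (word t ∘ sigmaConj lam mu) := by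
  intro r s hrs hb hw
  simp only [Function.comp_apply, word_sigmaConj] at hw ⊢
  rcases lt_or_gt_of_ne hrs with h | h
  · rcases colRead_lt _ h with h1 | h1
    · exact absurd hb h1.ne
    · exact (ht _ _ h1.1 h1.2).2 hw
  · rcases colRead_lt _ h with h1 | h1
    · exact absurd hb h1.ne'
    · rw [hw]; exact (ht _ _ h1.1 h1.2).2 hw.symm

theorem weight_colBlock (w : Fin (skewSize lam mu) → Fin N) :
    weight (colBlock lam mu) (w ∘ sigmaConj lam mu) =
      ∑ r, (rowRead (skewCells lam mu) r).1.2 * (w r : ℕ) := by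
  rw [weight, ← Equiv.sum_comp (sigmaConj lam mu)
    fun r => (rowRead (skewCells lam mu) r).1.2 * (w r : ℕ)]
  refine Finset.sum_congr rfl fun r _ => ?_
  simp [colBlock, sigmaConj]

/-- Among the rearrangements of a word within the rows, the sorted one has the largest column
weight. -/
theorem weight_colBlock_le {w : Fin (skewSize lam mu) → Fin N}
    (hw : BlockSorted (rowBlock lam mu) w) {g : Equiv.Perm (Fin (skewSize lam mu))}
    (hg : g ∈ youngSubgroup (rowBlock lam mu)) :
    weight (colBlock lam mu) ((w ∘ g) ∘ sigmaConj lam mu) ≤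
        weight (colBlock lam mu) (w ∘ sigmaConj lam mu) ∧
      (weight (colBlock lam mu) ((w ∘ g) ∘ sigmaConj lam mu) =
        weight (colBlock lam mu) (w ∘ sigmaConj lam mu) → w ∘ g = w) := by
  rw [weight_colBlock, weight_colBlock]
  set row := rowBlock lam mu with hrow
  set col : Fin (skewSize lam mu) → ℕ := fun r => (rowRead (skewCells lam mu) r).1.2 with hcol
  -- `K` exceeds every column index and `N` every letter. Adding these multiples of the row makes
  -- `f` and `F` monotone along the whole reading order, so the rearrangement inequality applies at
  -- once to all rows; the added terms cancel because `g` preserves rows.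
  set K := ∑ r, col r + 1 with hK
  have hcK : ∀ r, col r < K := fun r =>
    Nat.lt_succ_of_le (Finset.single_le_sum (f := col) (fun _ _ => Nat.zero_le _)
      (Finset.mem_univ r))
  let f : Fin (skewSize lam mu) → ℤ := fun r => col r + K * row r
  let F : Fin (skewSize lam mu) → ℤ := fun r => (w r : ℕ) + N * row r
  have hf : StrictMono f := by
    intro r s h
    simp only [f]
    rcases rowRead_lt _ h with h1 | h1
    · have h2 : row r + 1 ≤ row s := h1
      have h3 := hcK r
      have h4 : K * (row r + 1) ≤ K * row s := Nat.mul_le_mul_left K h2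
      have h5 : col r + K * row r < col s + K * row s := by rw [mul_add, mul_one] at h4; omega
      exact_mod_cast h5
    · have h2 : row r = row s := h1.1
      have h3 : col r < col s := h1.2
      rw [h2]
      omega
  have hF : Monotone F := by
    intro r s h
    simp only [F]
    have h1 := hw h
    rw [Prod.Lex.le_iff] at h1
    rcases h1 with h1 | h1
    · have h2 : row r + 1 ≤ row s := h1
      have h3 := (w r).2
      have h4 : N * (row r + 1) ≤ N * row s := Nat.mul_le_mul_left N h2
      have h5 : (w r : ℕ) + N * row r ≤ (w s : ℕ) + N * row s := by
        rw [mul_add, mul_one] at h4; omega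
      exact_mod_cast h5
    · have h2 : row r = row s := h1.1
      have h3 : w r ≤ w s := h1.2
      rw [h2]
      rw [Fin.le_def] at h3
      omega
  have hmv : Monovary f F := hf.monotone.monovary hF
  have hdiff : ((∑ r, col r * ((w ∘ g) r : ℕ) : ℕ) : ℤ) - (∑ r, col r * (w r : ℕ) : ℕ) =
      ∑ r, f r * F (g r) - ∑ r, f r * F r := by
    have h1 : ∑ r, (row r : ℤ) * (w (g r) : ℕ) = ∑ r, (row r : ℤ) * (w r : ℕ) := by
      have := weight_comp w hg
      simp only [weight, Function.comp_apply] at this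
      exact_mod_cast this
    have h2 : ∀ r, f r * F (g r) = (col r : ℤ) * (w (g r) : ℕ) +
        K * ((row r : ℤ) * (w (g r) : ℕ)) + f r * (N * row r) := by
      intro r
      have hgr : row (g r) = row r := hg r
      simp only [f, F, hgr]
      ring
    have h3 : ∀ r, f r * F r = (col r : ℤ) * (w r : ℕ) +
        K * ((row r : ℤ) * (w r : ℕ)) + f r * (N * row r) := by
      intro r
      simp only [f, F]
      ring
    simp only [h2, h3, Finset.sum_add_distrib, ← Finset.mul_sum, h1]
    push_cast
    simp only [Function.comp_apply]
    ring
  have hle := hmv.sum_mul_comp_perm_le_sum_mul (σ := g)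
  change ∑ r, col r * ((w ∘ g) r : ℕ) ≤ ∑ r, col r * (w r : ℕ) ∧
    (∑ r, col r * ((w ∘ g) r : ℕ) = ∑ r, col r * (w r : ℕ) → _)
  refine ⟨by omega, fun heq => ?_⟩
  -- Equality makes `F ∘ g` vary with the strictly increasing `f`, so `w ∘ g` is sorted as well.
  have hiff := (hmv.sum_mul_comp_perm_eq_sum_mul_iff (σ := g)).1 (by rw [heq] at hdiff; omega)
  refine hw.comp_eq hg fun r s h => ?_
  rcases h.lt_or_eq with h | h
  · rw [Prod.Lex.le_iff]
    have hFg : F (g r) ≤ F (g s) := by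
      by_contra! hlt
      exact absurd (hiff hlt) (not_le.2 (hf h))
    rcases (rowBlock_monotone h.le : row r ≤ row s).lt_or_eq with h1 | h1
    · exact Or.inl h1
    · refine Or.inr ⟨h1, ?_⟩
      have hgr : row (g r) = row s := (hg r).trans h1
      have hgs : row (g s) = row s := hg s
      simp only [F, hgr, hgs] at hFg
      change w (g r) ≤ w (g s)
      rw [Fin.le_def]
      omega
  · rw [h]

variable {k : Type u} [Field k] {M : SVec k} {Z : Module.Basis (Fin N) k M}

/-- A row rearrangement of the word of `t` meets the column orbit of `s` only if the column weight
of `s` is at most that of `t`. In case of a tie the rearrangement is trivial, and uniqueness of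
sorted column words gives `s = t`. -/
theorem linearIndependent_theta_zPi (hZ : ∀ i, Z i ∈ M.part (p i)) :
    LinearIndependent k fun t : CostandardTableau lam mu p =>
      (thetaConj lam mu k).app M (zPi Z hZ t.1 t.2.1) := by
  let φ : CostandardTableau lam mu p → (symShapeConj lam mu k).obj M →ₗ[k] k := fun t =>
    (symKerSpace M (colBlock lam mu)).liftQ
      (orbitCoeff Z p (colBlock lam mu) (word t.1 ∘ sigmaConj lam mu))
      (symKerSpace_le_ker_orbitCoeff hZ t.2.2.repeatsIn)
  have hφ : ∀ s t : CostandardTableau lam mu p,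
      φ s ((thetaConj lam mu k).app M (zPi Z hZ t.1 t.2.1)) =
        ∑ w, coeff Z w (divPow Z (rowBlock lam mu) (word t.1)) *
          (((koszulSign (p ∘ w) (sigmaConj lam mu) : ℤ) : k) * (orbitSign p (colBlock lam mu)
            (word s.1 ∘ sigmaConj lam mu) (w ∘ sigmaConj lam mu) : k)) := by
    intro s t
    rw [← orbitCoeff_superAct_eq_sum hZ, ← zPi_val hZ t.1 t.2.1]
    rfl
  have hsupp : ∀ (s t : CostandardTableau lam mu p) (w : Fin (skewSize lam mu) → Fin N),
      coeff Z w (divPow Z (rowBlock lam mu) (word t.1)) *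
          (((koszulSign (p ∘ w) (sigmaConj lam mu) : ℤ) : k) * (orbitSign p (colBlock lam mu)
            (word s.1 ∘ sigmaConj lam mu) (w ∘ sigmaConj lam mu) : k)) ≠ 0 →
      weight (colBlock lam mu) (word s.1 ∘ sigmaConj lam mu) ≤
          weight (colBlock lam mu) (word t.1 ∘ sigmaConj lam mu) ∧
        (weight (colBlock lam mu) (word s.1 ∘ sigmaConj lam mu) =
          weight (colBlock lam mu) (word t.1 ∘ sigmaConj lam mu) → s = t ∧ w = word t.1) := by
    intro s t w h0
    obtain ⟨g, hg, rfl⟩ := exists_of_coeff_divPow_ne_zero hZ (left_ne_zero_of_mul h0)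
    have h1 : orbitSign p (colBlock lam mu) (word s.1 ∘ sigmaConj lam mu)
        ((word t.1 ∘ g) ∘ sigmaConj lam mu) ≠ 0 := by
      intro e
      rw [e, Int.cast_zero, mul_zero, mul_zero] at h0
      exact h0 rfl
    obtain ⟨τ, hτ, e⟩ := exists_of_orbitSign_ne_zero h1
    have h2 := weight_colBlock_le (rowCostandard_iff.1 t.2.1).1 hg
    have h3 : weight (colBlock lam mu) (word s.1 ∘ sigmaConj lam mu) =
        weight (colBlock lam mu) ((word t.1 ∘ g) ∘ sigmaConj lam mu) := by
      rw [← e, weight_comp _ hτ]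
    refine ⟨h3.trans_le h2.1, fun heq => ?_⟩
    have h4 := h2.2 (h3.symm.trans heq)
    refine ⟨?_, h4⟩
    rw [h4] at e
    have h5 := t.2.2.blockSorted.comp_eq hτ (by rw [e]; exact s.2.2.blockSorted)
    rw [e] at h5
    refine Subtype.ext (funext fun a => ?_)
    have h6 := congrFun h5 ((colRead (skewCells lam mu)).symm a)
    simpa [word_sigmaConj] using h6
  refine linearIndependent_of_triangular φ
    (fun t => weight (colBlock lam mu) (word t.1 ∘ sigmaConj lam mu)) ?_ ?_
  · intro t
    rw [hφ, Finset.sum_eq_single (word t.1)]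
    · rw [coeff_divPow_self hZ (rowCostandard_iff.1 t.2.1).2, one_mul,
        orbitSign_eq t.2.2.repeatsIn (youngSubgroup _).one_mem rfl]
      exact mul_ne_zero (units_cast_ne_zero _) (units_cast_ne_zero _)
    · intro w _ hw
      by_contra h
      exact hw ((hsupp t t w h).2 rfl).2
    · simp
  · intro s t hst h
    rw [hφ] at h
    obtain ⟨w, _, hw⟩ := Finset.exists_ne_zero_of_sum_ne_zero h
    obtain ⟨h1, h2⟩ := hsupp s t w hw
    exact h1.lt_of_ne fun e => hst (h2 e).1

end Independence

/-! ### The isomorphism -/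

section Isomorphism

variable {k : Type u} [Field k] {d : ℕ}

/-- The image of `η` is the quotient of its source by its kernel. -/
theorem evenIso_image_quotient {F G : PolI k d} (η : EvenTrans F G) (U : SubPol F)
    (hU : ∀ M, U.sub M = LinearMap.ker (η.app M)) : EvenIso η.image.toPol U.quotient := by
  let e : ∀ M, (F.obj M ⧸ U.sub M) ≃ₗ[k] LinearMap.range (η.app M) := fun M =>
    (Submodule.quotEquivOfEq _ _ (hU M)).trans (η.app M).quotKerEquivRange
  have he : ∀ M x, e M (Submodule.Quotient.mk x) = ⟨η.app M x, x, rfl⟩ := fun M x => rfl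
  have he' : ∀ M x, (e M).symm ⟨η.app M x, x, rfl⟩ = Submodule.Quotient.mk x := fun M x => by
    rw [← he, LinearEquiv.symm_apply_apply]
  refine ⟨⟨fun M => (e M).symm.toLinearMap, ?_, ?_⟩, ⟨fun M => (e M).toLinearMap, ?_, ?_⟩,
    fun M x => (e M).apply_symm_apply x, fun M x => (e M).symm_apply_apply x⟩
  · rintro M δ ⟨_, x, rfl⟩ hy
    -- Evenness of the inverse: a homogeneous element of the image has a homogeneous preimage,
    -- obtained by projecting any preimage.
    have h1 : η.app M ((F.obj M).proj δ x) = η.app M x := by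
      rw [(η.even M).proj_comm]
      exact (G.obj M).proj_of_mem hy
    have h2 : (⟨η.app M x, x, rfl⟩ : LinearMap.range (η.app M)) =
        ⟨η.app M ((F.obj M).proj δ x), _, rfl⟩ := Subtype.ext h1.symm
    rw [zero_add]
    exact ⟨_, (F.obj M).proj_mem δ x, ((congrArg (e M).symm h2).trans (he' M _)).symm⟩
  · rintro M N φ ⟨_, x, rfl⟩
    have h2 : (η.image.toPol.map φ ⟨η.app M x, x, rfl⟩ : LinearMap.range (η.app N)) =
        ⟨η.app N (F.map φ x), _, rfl⟩ := Subtype.ext (η.natural φ x).symm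
    exact ((congrArg (e N).symm h2).trans (he' N _)).trans
      (congrArg (U.quotient.map φ) (he' M x)).symm
  · rintro M δ _ ⟨x, hx, rfl⟩
    exact η.even M δ x hx
  · intro M N φ y
    obtain ⟨x, rfl⟩ := Submodule.Quotient.mk_surjective _ y
    exact Subtype.ext (η.natural φ x)

theorem exists_homogeneous_basis (M : SVec k) :
    ∃ (N : ℕ) (Z : Module.Basis (Fin N) k M) (p : Fin N → ZMod 2), ∀ i, Z i ∈ M.part (p i) := by
  let B := ((Module.finBasis k (M.part 0)).prod (Module.finBasis k (M.part 1))).map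
    (Submodule.prodEquivOfIsCompl _ _ M.isCompl)
  refine ⟨_, B.reindex finSumFinEquiv, fun i => Sum.elim (fun _ => 0) (fun _ => 1)
    (finSumFinEquiv.symm i), fun i => ?_⟩
  obtain ⟨j, rfl⟩ := finSumFinEquiv.surjective i
  rcases j with j | j <;> simp [B]

variable {lam mu : YoungDiagram}

/-- Modulo `Im ◇` a kernel element is a combination of costandard elements, and `θ̂` is injective on
their span. -/
theorem ker_thetaConj (hk : ringChar k ≠ 2) (M : SVec k) :
    (imDiamond lam mu k).sub M = LinearMap.ker ((thetaConj lam mu k).app M) := by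
  refine le_antisymm (imDiamond_le_ker hk M) fun x hx => ?_
  obtain ⟨N, Z, p, hZ⟩ := exists_homogeneous_basis M
  have hx' : x ∈ Submodule.span k (Set.range fun t : CostandardTableau lam mu p =>
      zPi Z hZ t.1 t.2.1) ⊔ (imDiamond lam mu k).sub M := by
    rw [span_costandard_sup_imDiamond hk hZ]; trivial
  obtain ⟨y, hy, z, hz, rfl⟩ := Submodule.mem_sup.1 hx'
  have hz0 := imDiamond_le_ker hk M hz
  have hy0 : (thetaConj lam mu k).app M y = 0 := by
    have h1 : (thetaConj lam mu k).app M (y + z) = 0 := hx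
    have h2 : (thetaConj lam mu k).app M z = 0 := hz0
    rwa [map_add, h2, add_zero] at h1
  have hli : LinearIndependent k ((thetaConj lam mu k).app M ∘
      fun t : CostandardTableau lam mu p => zPi Z hZ t.1 t.2.1) := linearIndependent_theta_zPi hZ
  have hy1 : y = 0 :=
    Submodule.disjoint_def.1 (Submodule.range_ker_disjoint hli) y hy hy0
  rwa [hy1, zero_add]

end Isomorphism

end SchurSuper

end

open SchurSuper in
theorem theorem3 {k : Type u} [Field k] (hk : ringChar k ≠ 2)
    (lam mu : YoungDiagram) (hmu : mu ≤ lam) :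
    (∀ (M : SVec k) (m n : ℕ), M.HasSDim m n →
      ∀ (Z : Module.Basis (Fin (m + n)) k M) (p : Fin (m + n) → ZMod 2)
        (hZ : ∀ i, Z i ∈ M.part (p i)),
        LinearIndependent k (fun t : CostandardTableau lam mu p =>
          (thetaConj lam mu k).toImage.app M (zPi Z hZ t.1 t.2.1)) ∧
        Submodule.span k (Set.range (fun t : CostandardTableau lam mu p =>
          (thetaConj lam mu k).toImage.app M (zPi Z hZ t.1 t.2.1))) =
            (⊤ : Submodule k ((schurConj lam mu k).obj M))) ∧
    EvenIso (schurConj lam mu k) (imDiamond lam mu k).quotient := by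
  refine ⟨fun M m n _ Z p hZ => ⟨?_, ?_⟩,
    evenIso_image_quotient _ _ fun M => ker_thetaConj hk M⟩
  · exact LinearIndependent.of_comp
      (LinearMap.range ((thetaConj lam mu k).app M)).subtype (linearIndependent_theta_zPi hZ)
  -- Apply the corestricted `θ̂` to the spanning statement; the summand `Im ◇` disappears.
  · have h := congrArg (Submodule.map ((thetaConj lam mu k).toImage.app M))
      (span_costandard_sup_imDiamond (lam := lam) (mu := mu) hk hZ)
    have h0 : ((imDiamond lam mu k).sub M).map ((thetaConj lam mu k).toImage.app M) = ⊥ := by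
      rw [eq_bot_iff, Submodule.map_le_iff_le_comap]
      intro x hx
      exact Subtype.ext (imDiamond_le_ker hk M hx)
    rw [Submodule.map_sup, h0, sup_bot_eq, Submodule.map_span, ← Set.range_comp,
      Submodule.map_top] at h
    exact h.trans (LinearMap.range_rangeRestrict _)
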